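/- An oriented matroid $\mathcal M$ on a finite set $E$ is given by its set of signed circuits $X\in\{+,-,0\}^E$. It is $k$-neighborly if $|X^+|>k$ and $|X^-|>k$ for every circuit $X$. For $R\subseteq E$, the reorientation ${}_{-R}\mathcal M$ is obtained by reversing the sign of $X_e$ for every $e\in R$ and every circuit $X$; the reorientation class of $\mathcal M$ is $[\mathcal M]=\{{}_{-R}\mathcal M : R\subseteq E\}$. For $\mathcal M$ of rank $r$ on $n$ elements let $f_{\mathcal M}(r,n,k)$ be the number of subsets $R\subseteq E$ such that ${}_{-R}\mathcal M$ is $k$-neighborly. The alternating oriented matroid $C_r(n)$ is the uniform oriented matroid of rank $r$ on $\{1,\dots,n\}$ whose circuits are the sign vectors with support $\{i_1<\dots<i_{r+1}\}$ and $X_{i_{j+1}}=-X_{i_j}$ for $1\le j\le r$; put $c_r(n,k)=f_{C_r(n)}(r,n,k)$. A Lawrence oriented matroid (LOM) of rank $r$ on $\{1,\dots,n\}$ is a uniform oriented matroid of rank $r$ that has a chirotope $\chi$ of the form $\chi(j_1,\dots,j_r)=\prod_{i=1}^r a_{i,j_i}$ for all $j_1<\dots<j_r$, for some $r\times n$ matrix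 $(a_{i,j})$ with entries in $\{+1,-1\}$. Theorem. One has $c_7(11,2)=112$. Every LOM $\mathcal M$ of rank $7$ on $11$ elements with $\mathcal M\notin[C_7(11)]$ satisfies $f_{\mathcal M}(7,11,2)\le c_7(11,2)=112$. There are exactly $255$ reorientation classes $[\mathcal M]$ of such LOMs, that is, of LOMs $\mathcal M$ of rank $7$ on $11$ elements with $\mathcal M\notin[C_7(11)]$, for which $f_{\mathcal M}(7,11,2)=c_7(11,2)$. -/

import Mathlib

/-- The support of a sign vector. -/
def SignVec.supp {E : Type*} [Fintype E] (X : E → SignType) : Finset E :=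
  Finset.univ.filter (fun e => X e ≠ 0)

/-- The set of positive elements of a sign vector. -/
def SignVec.pos {E : Type*} [Fintype E] (X : E → SignType) : Finset E :=
  Finset.univ.filter (fun e => X e = 1)

/-- The set of negative elements of a sign vector. -/
def SignVec.neg {E : Type*} [Fintype E] (X : E → SignType) : Finset E :=
  Finset.univ.filter (fun e => X e = -1)

/-- Reverse the signs of a sign vector at the elements of `R`. -/
def SignVec.flip {E : Type*} [DecidableEq E] (R : Finset E) (X : E → SignType) :
    E → SignType :=
  fun e => if e ∈ R then -X e else X e

/-- An oriented matroid on the finite ground set `E`, given by its signed circuits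
(nonzero, symmetric, incomparable, weak elimination). -/
@[ext]
structure OrientedMatroid (E : Type*) [Fintype E] where
  circuits : Set (E → SignType)
  zero_notMem : (0 : E → SignType) ∉ circuits
  neg_mem : ∀ X ∈ circuits, -X ∈ circuits
  incomparable : ∀ X ∈ circuits, ∀ Y ∈ circuits,
    SignVec.supp X ⊆ SignVec.supp Y → X = Y ∨ X = -Y
  elimination : ∀ X ∈ circuits, ∀ Y ∈ circuits, X ≠ -Y → ∀ e, X e = 1 → Y e = -1 →
    ∃ Z ∈ circuits, Z e = 0 ∧ (∀ f, Z f = 1 → X f = 1 ∨ Y f = 1) ∧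
      (∀ f, Z f = -1 → X f = -1 ∨ Y f = -1)

theorem SignVec.flip_flip {E : Type*} [DecidableEq E] (R : Finset E) (X : E → SignType) :
    SignVec.flip R (SignVec.flip R X) = X := by
  funext e; by_cases h : e ∈ R <;> simp [SignVec.flip, h]

theorem SignVec.flip_neg {E : Type*} [DecidableEq E] (R : Finset E) (X : E → SignType) :
    SignVec.flip R (-X) = -SignVec.flip R X := by
  funext e; by_cases h : e ∈ R <;> simp [SignVec.flip, h]

theorem SignVec.flip_apply_eq_zero {E : Type*} [DecidableEq E] (R : Finset E)
    (X : E → SignType) (e : E) : SignVec.flip R X e = 0 ↔ X e = 0 := by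
  by_cases h : e ∈ R <;> simp [SignVec.flip, h]

theorem SignVec.supp_flip {E : Type*} [Fintype E] [DecidableEq E] (R : Finset E)
    (X : E → SignType) : SignVec.supp (SignVec.flip R X) = SignVec.supp X := by
  ext e; simp [SignVec.supp, SignVec.flip_apply_eq_zero]

namespace OrientedMatroid

/-- The reorientation of `R`: the signs at the elements of `R` are reversed in every circuit. -/
def reorient {E : Type*} [Fintype E] [DecidableEq E] (M : OrientedMatroid E)
    (R : Finset E) : OrientedMatroid E where
  circuits := SignVec.flip R '' M.circuits
  zero_notMem := by
    rintro ⟨X, hX, h⟩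
    apply M.zero_notMem
    have : X = 0 := by
      funext e
      have := congrFun h e
      exact (SignVec.flip_apply_eq_zero R X e).1 this
    exact this ▸ hX
  neg_mem := by
    rintro _ ⟨X, hX, rfl⟩
    exact ⟨-X, M.neg_mem X hX, SignVec.flip_neg R X⟩
  incomparable := by
    rintro _ ⟨X, hX, rfl⟩ _ ⟨Y, hY, rfl⟩ h
    rw [SignVec.supp_flip, SignVec.supp_flip] at h
    rcases M.incomparable X hX Y hY h with h | h
    · exact Or.inl (by rw [h])
    · exact Or.inr (by rw [h, SignVec.flip_neg])
  elimination := by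
    rintro _ ⟨X, hX, rfl⟩ _ ⟨Y, hY, rfl⟩ hne e hXe hYe
    have hne' : X ≠ -Y := fun h => hne (by rw [h, SignVec.flip_neg])
    have key : ∃ Z ∈ M.circuits, Z e = 0 ∧ (∀ f, Z f = 1 → X f = 1 ∨ Y f = 1) ∧
        (∀ f, Z f = -1 → X f = -1 ∨ Y f = -1) := by
      by_cases he : e ∈ R
      · simp only [SignVec.flip, he, if_true] at hXe hYe
        have h1 : Y e = 1 := by simpa using hYe
        have h2 : X e = -1 := by rw [← hXe, neg_neg]
        obtain ⟨Z, hZ, h0, hp, hn⟩ := M.elimination Y hY X hX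
          (fun h => hne' (by rw [h, neg_neg])) e h1 h2
        exact ⟨Z, hZ, h0, fun f hf => (hp f hf).symm, fun f hf => (hn f hf).symm⟩
      · simp only [SignVec.flip, he, if_false] at hXe hYe
        exact M.elimination X hX Y hY hne' e hXe hYe
    obtain ⟨Z, hZ, h0, hp, hn⟩ := key
    refine ⟨_, ⟨Z, hZ, rfl⟩, (SignVec.flip_apply_eq_zero R Z e).2 h0, fun f hf => ?_,
      fun f hf => ?_⟩
    · by_cases h : f ∈ R
      · simp only [SignVec.flip, h, if_true, neg_eq_iff_eq_neg] at hf ⊢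
        exact hn f hf
      · simp only [SignVec.flip, h, if_false] at hf ⊢
        exact hp f hf
    · by_cases h : f ∈ R
      · simp only [SignVec.flip, h, if_true, neg_inj] at hf ⊢
        exact hp f hf
      · simp only [SignVec.flip, h, if_false] at hf ⊢
        exact hn f hf

/-- The reorientation class of `M`. -/
def reorientationClass {E : Type*} [Fintype E] [DecidableEq E] (M : OrientedMatroid E) :
    Set (OrientedMatroid E) :=
  Set.range M.reorient

/-- `M` is `k`-neighborly if every circuit has more than `k` positive and more than `k`
negative elements. -/
def IsNeighborly {E : Type*} [Fintype E] (M : OrientedMatroid E) (k : ℕ) : Prop :=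
  ∀ X ∈ M.circuits, k < (SignVec.pos X).card ∧ k < (SignVec.neg X).card

/-- The number of `k`-neighborly reorientations, i.e. of subsets `R` of the ground set whose
reorientation is `k`-neighborly. -/
noncomputable def neighborlyCount {E : Type*} [Fintype E] [DecidableEq E]
    (M : OrientedMatroid E) (k : ℕ) : ℕ :=
  {R : Finset E | (M.reorient R).IsNeighborly k}.ncard

/-- A set is independent if it does not contain the support of a circuit. -/
def Indep {E : Type*} [Fintype E] (M : OrientedMatroid E) (S : Finset E) : Prop :=
  ∀ X ∈ M.circuits, ¬ SignVec.supp X ⊆ S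

/-- `M` has rank `r`: a largest independent set has size `r`. -/
def HasRank {E : Type*} [Fintype E] (M : OrientedMatroid E) (r : ℕ) : Prop :=
  IsGreatest {m : ℕ | ∃ S : Finset E, M.Indep S ∧ S.card = m} r

/-- All circuits of the rank `r` oriented matroid `M` have size `r + 1`. -/
def IsUniform {E : Type*} [Fintype E] (M : OrientedMatroid E) (r : ℕ) : Prop :=
  M.HasRank r ∧ ∀ X ∈ M.circuits, (SignVec.supp X).card = r + 1

/-- `χ` is a chirotope (basis orientation) of the rank `r` oriented matroid `M`: it is
alternating, it is nonzero exactly on the ordered bases, and if `B'` arises from `B` by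
replacing the element `e` by `f` (in the same position), and `X` is a circuit inside `B ∪ {f}`
with `e`, `f` in its support, then `χ(B') = - X_e X_f χ(B)`. -/
structure IsChirotope {E : Type*} [Fintype E] [DecidableEq E] (M : OrientedMatroid E) (r : ℕ)
    (χ : (Fin r → E) → SignType) : Prop where
  hasRank : M.HasRank r
  alternating : ∀ (x : Fin r → E) (i j : Fin r), i ≠ j → χ (x ∘ Equiv.swap i j) = -χ x
  ne_zero_iff : ∀ x : Fin r → E,
    χ x ≠ 0 ↔ Function.Injective x ∧ M.Indep (Finset.univ.image x)
  exchange : ∀ (x : Fin r → E) (i : Fin r) (f : E), ∀ X ∈ M.circuits, f ≠ x i →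
    SignVec.supp X ⊆ insert f (Finset.univ.image x) → X (x i) ≠ 0 → X f ≠ 0 →
    χ (Function.update x i f) = -(X (x i) * X f * χ x)

/-- `M` is a Lawrence oriented matroid of rank `r` on the ordered set `Fin n`: a uniform
oriented matroid with a chirotope `χ` and an `r × n` matrix `A` of signs `±1` such that
`χ(j₁, …, j_r) = a_{1,j₁} ⋯ a_{r,j_r}` for all `j₁ < ⋯ < j_r`. -/
def IsLawrence {n : ℕ} (M : OrientedMatroid (Fin n)) (r : ℕ) : Prop :=
  M.IsUniform r ∧
  ∃ (A : Matrix (Fin r) (Fin n) SignType) (χ : (Fin r → Fin n) → SignType),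
    (∀ i j, A i j ≠ 0) ∧ M.IsChirotope r χ ∧
    ∀ j : Fin r → Fin n, StrictMono j → χ j = ∏ i, A i (j i)

end OrientedMatroid

/-- A sign vector on `Fin n` is alternating if any two consecutive elements of its support
have opposite signs. -/
def SignVec.IsAlternating {n : ℕ} (X : Fin n → SignType) : Prop :=
  ∀ i j, i < j → X i ≠ 0 → X j ≠ 0 → (∀ l, i < l → l < j → X l = 0) → X j = -X i

theorem SignVec.IsAlternating.neg {n : ℕ} {X : Fin n → SignType}
    (hX : SignVec.IsAlternating X) : SignVec.IsAlternating (-X) := by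
  intro i j hij hi hj h
  have := hX i j hij (by simpa using hi) (by simpa using hj)
    (fun l h1 h2 => by simpa using h l h1 h2)
  simp [this]

theorem SignVec.IsAlternating.rev {n : ℕ} {X : Fin n → SignType}
    (hX : SignVec.IsAlternating X) : SignVec.IsAlternating (fun i => X i.rev) := by
  intro i j hij hi hj h
  have := hX j.rev i.rev (by simpa using hij) hj hi (fun l h1 h2 => by
    have := h l.rev (by rw [← Fin.rev_lt_rev]; simpa using h2)
      (by rw [← Fin.rev_lt_rev]; simpa using h1)
    simpa using this)
  change X j.rev = -X i.rev
  rw [this, neg_neg]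

/-- The core of the elimination axiom, when the two vectors differ at `l < e`. -/
theorem SignVec.alternating_aux {n : ℕ} {X Y : Fin n → SignType}
    (hX : SignVec.IsAlternating X) (hY : SignVec.IsAlternating Y) {e l : Fin n}
    (hle : l < e) (he : X e ≠ 0) (heY : Y e = -X e) (hl : X l ≠ 0) (hlY : Y l = 0)
    (hbet : ∀ k, l < k → k < e → Y k = -X k) :
    ∃ Z : Fin n → SignType, SignVec.IsAlternating Z ∧ Z e = 0 ∧
      (∀ k, Z k = 0 ∨ Z k = X k ∨ Z k = Y k) ∧
      (∀ k, Z k ≠ 0 ↔ k = l ∨ (Y k ≠ 0 ∧ k ≠ e)) := by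
  have hYe : Y e ≠ 0 := by rw [heY]; simpa using he
  have hYX : ∀ k, l < k → k < e → (X k = 0 ↔ Y k = 0) := fun k h1 h2 => by
    rw [hbet k h1 h2]; simp
  refine ⟨fun k => if k < l then Y k else if k < e then X k else if k = e then 0 else Y k,
    ?_, ?_, ?_, ?_⟩
  · -- the next common support element after `l`
    obtain ⟨f, hlf, hfe, hXf, hYf, hf0⟩ : ∃ f, l < f ∧ f ≤ e ∧ X f ≠ 0 ∧ Y f = -X f ∧
        ∀ k, l < k → k < f → X k = 0 := by
      classical
      have hne : (Finset.univ.filter (fun k => l < k ∧ X k ≠ 0)).Nonempty :=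
        ⟨e, by simp [hle, he]⟩
      obtain ⟨f, hf, hmin⟩ := Finset.exists_min_image _ id hne
      simp only [Finset.mem_filter, Finset.mem_univ, true_and, id] at hf hmin
      have hfe : f ≤ e := hmin e ⟨hle, he⟩
      refine ⟨f, hf.1, hfe, hf.2, ?_, fun k h1 h2 => ?_⟩
      · rcases hfe.lt_or_eq with h | h
        · exact hbet f hf.1 h
        · rw [h, heY]
      · by_contra h3
        exact absurd (hmin k ⟨h1, h3⟩) (not_le.2 h2)
    have hXl : X f = -X l := hX l f hlf hl hXf hf0
    have hYf0 : Y f ≠ 0 := by rw [hYf]; simpa using hXf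
    have hYl : ∀ i, i < l → Y i ≠ 0 → (∀ k, i < k → k < l → Y k = 0) → X l = -Y i := by
      intro i hil hi h0
      have : Y f = -Y i := hY i f (hil.trans hlf) hi hYf0 (fun k h1 h2 => by
        rcases lt_trichotomy k l with h | h | h
        · exact h0 k h1 h
        · rw [h, hlY]
        · exact (hYX k h (h2.trans_le hfe)).1 (hf0 k h h2))
      rw [hYf, hXl, neg_neg] at this
      exact this
    intro i j hij hi hj h
    have hval : ∀ k, (k < l ∧ (if k < l then Y k else if k < e then X k else
          if k = e then 0 else Y k) = Y k) ∨
        (l ≤ k ∧ k < e ∧ (if k < l then Y k else if k < e then X k else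
          if k = e then 0 else Y k) = X k) ∨
        (k = e ∧ (if k < l then Y k else if k < e then X k else
          if k = e then 0 else Y k) = 0) ∨
        (e < k ∧ (if k < l then Y k else if k < e then X k else
          if k = e then 0 else Y k) = Y k) := by
      intro k
      grind
    beta_reduce at hi hj h ⊢
    rcases hval i with ⟨i1, ei⟩ | ⟨i1, i2, ei⟩ | ⟨i1, ei⟩ | ⟨i1, ei⟩ <;>
    rcases hval j with ⟨j1, ej⟩ | ⟨j1, j2, ej⟩ | ⟨j1, ej⟩ | ⟨j1, ej⟩ <;>
    rw [ei] at hi ⊢ <;> rw [ej] at hj ⊢ <;> (try exact absurd rfl hi) <;>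
    (try exact absurd rfl hj) <;> (try (exfalso; omega))
    · exact hY i j hij hi hj (fun k h1 h2 => by have := h k h1 h2; grind)
    · have hjl : j = l := by
        by_contra hne
        have h3 : l < j := lt_of_le_of_ne j1 (Ne.symm hne)
        have := h l i1 h3
        grind
      subst hjl
      exact hYl i i1 hi (fun k h1 h2 => by have := h k h1 h2; grind)
    · exfalso
      have := h l i1 (hle.trans j1)
      grind
    · exact hX i j hij hi hj (fun k h1 h2 => by have := h k h1 h2; grind)
    · have hXi : X e = -X i := hX i e i2 hi he
        (fun k h1 h2 => by have := h k h1 (h2.trans j1); grind)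
      have hYj : Y j = -Y e := hY e j j1 hYe hj
        (fun k h1 h2 => by have := h k (i2.trans h1) h2; grind)
      rw [hYj, heY, hXi, neg_neg]
    · exact hY i j hij hi hj (fun k h1 h2 => by have := h k h1 h2; grind)
  · grind
  · intro k; grind
  · intro k
    have := hYX k
    grind

/-- Two alternating sign vectors that are opposite at `e` and not opposite to each other admit
an elimination of `e` that exchanges one element of one of the two supports. -/
theorem SignVec.alternating_elim {n : ℕ} {X Y : Fin n → SignType}
    (hX : SignVec.IsAlternating X) (hY : SignVec.IsAlternating Y) {e : Fin n}
    (he : X e ≠ 0) (heY : Y e = -X e) (hne : X ≠ -Y) :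
    ∃ l, (X l ≠ 0 ∧ Y l = 0 ∧ ∃ Z : Fin n → SignType, SignVec.IsAlternating Z ∧ Z e = 0 ∧
      (∀ k, Z k = 0 ∨ Z k = X k ∨ Z k = Y k) ∧
      (∀ k, Z k ≠ 0 ↔ k = l ∨ (Y k ≠ 0 ∧ k ≠ e))) ∨
     (Y l ≠ 0 ∧ X l = 0 ∧ ∃ Z : Fin n → SignType, SignVec.IsAlternating Z ∧ Z e = 0 ∧
      (∀ k, Z k = 0 ∨ Z k = X k ∨ Z k = Y k) ∧
      (∀ k, Z k ≠ 0 ↔ k = l ∨ (X k ≠ 0 ∧ k ≠ e))) := by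
  -- the case of a difference on the left of `e`
  have left : ∀ {X Y : Fin n → SignType}, SignVec.IsAlternating X → SignVec.IsAlternating Y →
      ∀ {e : Fin n}, X e ≠ 0 → Y e = -X e → (∃ l, l < e ∧ Y l ≠ -X l) →
      ∃ l, (X l ≠ 0 ∧ Y l = 0 ∧ ∃ Z : Fin n → SignType, SignVec.IsAlternating Z ∧ Z e = 0 ∧
        (∀ k, Z k = 0 ∨ Z k = X k ∨ Z k = Y k) ∧
        (∀ k, Z k ≠ 0 ↔ k = l ∨ (Y k ≠ 0 ∧ k ≠ e))) ∨
       (Y l ≠ 0 ∧ X l = 0 ∧ ∃ Z : Fin n → SignType, SignVec.IsAlternating Z ∧ Z e = 0 ∧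
        (∀ k, Z k = 0 ∨ Z k = X k ∨ Z k = Y k) ∧
        (∀ k, Z k ≠ 0 ↔ k = l ∨ (X k ≠ 0 ∧ k ≠ e))) := by
    clear hX hY he heY hne e X Y
    intro X Y hX hY e he heY hex
    obtain ⟨l, hl, hmax⟩ := Finset.exists_max_image
      (Finset.univ.filter (fun l => l < e ∧ Y l ≠ -X l)) id
      (by obtain ⟨l, h1, h2⟩ := hex; exact ⟨l, by simp [h1, h2]⟩)
    simp only [Finset.mem_filter, Finset.mem_univ, true_and, id] at hl hmax
    have hbet : ∀ k, l < k → k < e → Y k = -X k := fun k h1 h2 => by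
      by_contra h3
      exact absurd (hmax k ⟨h2, h3⟩) (not_le.2 h1)
    refine ⟨l, ?_⟩
    by_cases hXl : X l = 0
    · have hYl : Y l ≠ 0 := fun h => hl.2 (by rw [h, hXl]; rfl)
      obtain ⟨Z, h1, h2, h3, h4⟩ := SignVec.alternating_aux hY hX hl.1
        (by rw [heY]; simpa using he) (by rw [heY, neg_neg]) hYl hXl
        (fun k h1 h2 => by rw [hbet k h1 h2, neg_neg])
      exact Or.inr ⟨hYl, hXl, Z, h1, h2, fun k => by have := h3 k; tauto, h4⟩
    · by_cases hYl : Y l = 0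
      · obtain ⟨Z, h⟩ := SignVec.alternating_aux hX hY hl.1 he heY hXl hYl hbet
        exact Or.inl ⟨hXl, hYl, Z, h⟩
      · exfalso
        obtain ⟨f, hf, hmin⟩ := Finset.exists_min_image
          (Finset.univ.filter (fun k => l < k ∧ X k ≠ 0)) id
          ⟨e, by simp [hl.1, he]⟩
        simp only [Finset.mem_filter, Finset.mem_univ, true_and, id] at hf hmin
        have hfe : f ≤ e := hmin e ⟨hl.1, he⟩
        have hf0 : ∀ k, l < k → k < f → X k = 0 := fun k h1 h2 => by
          by_contra h3
          exact absurd (hmin k ⟨h1, h3⟩) (not_le.2 h2)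
        have hYf : Y f = -X f := by
          rcases hfe.lt_or_eq with h | h
          · exact hbet f hf.1 h
          · rw [h, heY]
        have e1 := hX l f hf.1 hXl hf.2 hf0
        have e2 := hY l f hf.1 hYl (by rw [hYf]; simpa using hf.2) (fun k h1 h2 => by
          rw [hbet k h1 (h2.trans_le hfe), hf0 k h1 h2]; rfl)
        apply hl.2
        rw [hYf, e1, neg_neg] at e2
        rw [e2, neg_neg]
  obtain ⟨l, hl⟩ : ∃ l, Y l ≠ -X l := by
    by_contra! h
    exact hne (funext fun k => by simp [h k])
  rcases lt_trichotomy l e with h | h | h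
  · exact left hX hY he heY ⟨l, h, hl⟩
  · exact absurd heY (h ▸ hl)
  · obtain ⟨m, hm⟩ := left hX.rev hY.rev (e := e.rev) (by simpa using he) (by simpa using heY)
      ⟨l.rev, by simpa using h, by simpa using hl⟩
    refine ⟨m.rev, ?_⟩
    rcases hm with ⟨h1, h2, Z, h3, h4, h5, h6⟩ | ⟨h1, h2, Z, h3, h4, h5, h6⟩
    · exact Or.inl ⟨h1, h2, fun i => Z i.rev, h3.rev, h4,
        fun k => by simpa using h5 k.rev, fun k => by
          rw [h6 k.rev, Fin.rev_rev, Fin.rev_eq_iff, Fin.rev_injective.ne_iff]⟩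
    · exact Or.inr ⟨h1, h2, fun i => Z i.rev, h3.rev, h4,
        fun k => by simpa using h5 k.rev, fun k => by
          rw [h6 k.rev, Fin.rev_rev, Fin.rev_eq_iff, Fin.rev_injective.ne_iff]⟩

namespace OrientedMatroid

/-- The alternating oriented matroid `C_r(n)` on `Fin n`: the circuits are the alternating
sign vectors with support of size `r + 1`. It has rank `r` for `r ≤ n`. -/
def alternating (r n : ℕ) : OrientedMatroid (Fin n) where
  circuits := {X | (SignVec.supp X).card = r + 1 ∧ SignVec.IsAlternating X}
  zero_notMem := by
    rintro ⟨h, -⟩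
    simp [SignVec.supp] at h
  neg_mem := by
    rintro X ⟨h1, h2⟩
    exact ⟨by simpa [SignVec.supp] using h1, h2.neg⟩
  incomparable := by
    rintro X ⟨hX1, hX2⟩ Y ⟨hY1, hY2⟩ hsub
    have heq : SignVec.supp X = SignVec.supp Y :=
      Finset.eq_of_subset_of_card_le hsub (by rw [hX1, hY1])
    have hz : ∀ k, X k ≠ 0 ↔ Y k ≠ 0 := fun k => by
      have := Finset.ext_iff.1 heq k
      simpa only [SignVec.supp, Finset.mem_filter, Finset.mem_univ, true_and] using this
    obtain ⟨e, he⟩ : (SignVec.supp X).Nonempty := by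
      rw [← Finset.card_pos]; omega
    simp only [SignVec.supp, Finset.mem_filter, Finset.mem_univ, true_and] at he
    have hsign : ∀ a b : SignType, a ≠ 0 → b ≠ 0 → b = a ∨ b = -a := by decide
    rcases hsign (X e) (Y e) he ((hz e).1 he) with h | h
    · left
      by_contra hne
      obtain ⟨l, ⟨h1, h2, -⟩ | ⟨h1, h2, -⟩⟩ := SignVec.alternating_elim hX2 hY2.neg he
        (by simp [h]) (by rwa [neg_neg])
      · exact (hz l).1 h1 (by simpa using h2)
      · exact (hz l).2 (by simpa using h1) h2
    · right
      by_contra hne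
      obtain ⟨l, ⟨h1, h2, -⟩ | ⟨h1, h2, -⟩⟩ := SignVec.alternating_elim hX2 hY2 he h hne
      · exact (hz l).1 h1 h2
      · exact (hz l).2 h1 h2
  elimination := by
    rintro X ⟨hX1, hX2⟩ Y ⟨hY1, hY2⟩ hne e hXe hYe
    have hcard : ∀ (Y Z : Fin n → SignType) (l : Fin n), (SignVec.supp Y).card = r + 1 →
        Y e ≠ 0 → Y l = 0 → (∀ k, Z k ≠ 0 ↔ k = l ∨ (Y k ≠ 0 ∧ k ≠ e)) →
        (SignVec.supp Z).card = r + 1 := by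
      intro Y Z l hY he hl hZ
      have : SignVec.supp Z = insert l ((SignVec.supp Y).erase e) := by
        ext k
        simp only [SignVec.supp, Finset.mem_filter, Finset.mem_univ, true_and,
          Finset.mem_insert, Finset.mem_erase, hZ k]
        tauto
      rw [this, Finset.card_insert_of_notMem (by simp [SignVec.supp, hl]),
        Finset.card_erase_of_mem (by simpa [SignVec.supp] using he), hY]
      rfl
    have hfin : ∀ Z : Fin n → SignType, (∀ k, Z k = 0 ∨ Z k = X k ∨ Z k = Y k) →
        (∀ f, Z f = 1 → X f = 1 ∨ Y f = 1) ∧ (∀ f, Z f = -1 → X f = -1 ∨ Y f = -1) := by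
      intro Z hZ
      constructor <;> intro f hf <;> rcases hZ f with h | h | h
      · rw [h] at hf; exact absurd hf (by decide)
      · exact Or.inl (h ▸ hf)
      · exact Or.inr (h ▸ hf)
      · rw [h] at hf; exact absurd hf (by decide)
      · exact Or.inl (h ▸ hf)
      · exact Or.inr (h ▸ hf)
    have hX0 : X e ≠ 0 := by rw [hXe]; decide
    have hY0 : Y e ≠ 0 := by rw [hYe]; decide
    obtain ⟨l, ⟨h1, h2, Z, h3, h4, h5, h6⟩ | ⟨h1, h2, Z, h3, h4, h5, h6⟩⟩ :=
      SignVec.alternating_elim hX2 hY2 hX0 (by rw [hXe, hYe]) hne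
    · exact ⟨Z, ⟨hcard Y Z l hY1 hY0 h2 h6, h3⟩, h4, hfin Z h5⟩
    · exact ⟨Z, ⟨hcard X Z l hX1 hX0 h2 h6, h3⟩, h4, hfin Z h5⟩

end OrientedMatroid

/-! The circuits of a LOM can be read off its matrix row by row. If the support is `j 0 < ⋯ < j r`,
passing from `j i` to `j (i + 1)` involves only row `i`: the sign is multiplied by minus the product
of the two entries of that row (`IsUniform.circuits_eq_lawrenceCircuits`). Conversely every sign
matrix occurs, because it is realised by vectors whose maximal minors are dominated by their
diagonal terms (`isLawrence_lawrence`).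

For `r = 7`, `n = 11` the support satisfies `i ≤ j i ≤ i + 3`. Hence row `i` enters only through its
sign changes `D i t` between columns `i + t` and `i + t + 1`, `0 ≤ t ≤ 3`, and the circuits
determine these bits. A reorientation replaces `D i t` by `D i t + G (i + t)` mod 2, where `G` is an
arbitrary sequence of ten bits, each sequence arising from exactly two sets `R`, complementary to
each other. A unique `G` clears row `0` and offset `3`. The remaining 18 bits form a code, so the
reorientation classes of LOMs correspond bijectively to the `2 ^ 18` codes.

A circuit is, up to sign, a weakly increasing path of offsets `j i - i` in `{0, 1, 2, 3}`. A
recursion along the rows, which remembers the offset and the numbers of equal and opposite signs,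
decides whether some circuit violates 2-neighborliness. Summing over all `G` gives the number of
good `G` as a Boolean circuit in the 18 code bits. Evaluating that circuit on truth tables of `2 ^
18` bits treats all codes at once (`codeViolates_tables`): the number is at most 56, with equality
exactly on the codes that solve ten linear equations. Thus the maximum of the count is `2 * 56 =
112`, attained by `2 ^ 8 = 256` classes. One of them is the zero code, which is `C_7(11)`; 255
remain. -/

/-! ### Oriented matroids of vector configurations in general position -/

section Realizable

open Finset

variable {E : Type*} [Fintype E] {r : ℕ}

/-- `u` is a linear dependence of the vectors `V`. -/
def IsDependence (V : E → Fin r → ℝ) (u : E → ℝ) : Prop := ∑ e, u e • V e = 0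

/-- Any `r` of the vectors are linearly independent. -/
def GeneralPosition (V : E → Fin r → ℝ) : Prop :=
  r ≤ Fintype.card E ∧ ∀ S : Finset E, S.card = r → LinearIndepOn ℝ V (S : Set E)

theorem IsDependence.comb {V : E → Fin r → ℝ} {u v : E → ℝ} (hu : IsDependence V u)
    (hv : IsDependence V v) (a b : ℝ) : IsDependence V (fun e => a * u e + b * v e) := by
  unfold IsDependence at *
  simp only [add_smul, mul_smul, sum_add_distrib, ← smul_sum, hu, hv, smul_zero, add_zero]

/-- Enlarge `S` to exactly `r` elements, which is possible as `r ≤ |E|`; a dependence supported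
there vanishes by independence. So nonzero dependences have support of size at least `r + 1`. -/
theorem GeneralPosition.exists_ne_zero_notMem {V : E → Fin r → ℝ} (hV : GeneralPosition V)
    {u : E → ℝ} (hu : IsDependence V u) (h0 : u ≠ 0) {S : Finset E} (hS : S.card ≤ r) :
    ∃ e ∉ S, u e ≠ 0 := by
  by_contra! h
  obtain ⟨T, hST, hT⟩ := exists_superset_card_eq hS hV.1
  have hli := linearIndepOn_finset_iff.1 (hV.2 T hT) u (by
    rw [← hu]
    refine sum_subset (subset_univ _) fun e _ he => ?_
    rw [h e fun h' => he (hST h'), zero_smul])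
  apply h0
  funext e
  by_cases he : e ∈ T
  · exact hli e he
  · exact h e fun h' => he (hST h')

/-- More than `r` vectors in dimension `r` are dependent, and a zero coefficient inside `S` would
leave a nonzero dependence on only `r` elements. -/
theorem GeneralPosition.exists_dependence {V : E → Fin r → ℝ} (hV : GeneralPosition V)
    {S : Finset E} (hS : S.card = r + 1) :
    ∃ u, IsDependence V u ∧ ∀ e, u e ≠ 0 ↔ e ∈ S := by
  classical
  have hdep : ¬ LinearIndepOn ℝ V (S : Set E) := by
    intro h
    have := h.fintype_card_le_finrank
    simp [hS] at this
  obtain ⟨f, hf, i, hi, hfi⟩ : ∃ f : E → ℝ, ∑ i ∈ S, f i • V i = 0 ∧ ∃ i ∈ S, f i ≠ 0 := by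
    simpa [linearIndepOn_finset_iff] using hdep
  have hd : IsDependence V (fun e => if e ∈ S then f e else 0) := by
    unfold IsDependence
    rw [← hf, ← sum_subset (subset_univ S)]
    · exact sum_congr rfl fun e he => by simp [he]
    · intro e _ he; simp [he]
  refine ⟨_, hd, fun e => ⟨fun h => by_contra fun h' => h (by simp [h']), fun he h => ?_⟩⟩
  obtain ⟨g, hg, hg'⟩ := hV.exists_ne_zero_notMem hd
    (fun h' => hfi (by simpa [hi] using congrFun h' i)) (S := S.erase e)
    (by rw [card_erase_of_mem he, hS]; rfl)
  apply hg'
  by_cases hgS : g ∈ S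
  · have : g = e := by simpa [hgS] using hg
    subst this; exact h
  · simp [hgS]

/-- Conformal reduction, by induction on the support: as long as the support is too large, subtract
a multiple of a dependence on `r + 1` of its elements that cancels an element without reversing any
sign of `z`. This supplies the circuit in the elimination axiom. -/
theorem GeneralPosition.exists_conformal {V : E → Fin r → ℝ} (hV : GeneralPosition V)
    (z : E → ℝ) (hz : IsDependence V z) (h0 : z ≠ 0) :
    ∃ w, IsDependence V w ∧ (univ.filter fun e => w e ≠ 0).card = r + 1 ∧
      ∀ e, w e ≠ 0 → 0 < w e * z e := by
  classical
  induction hn : (univ.filter fun e => z e ≠ 0).card using Nat.strong_induction_on generalizing z with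
  | _ n ih =>
  have hlt : r + 1 ≤ n := by
    by_contra hlt
    obtain ⟨e, he, he'⟩ := hV.exists_ne_zero_notMem hz h0 (S := univ.filter fun e => z e ≠ 0)
      (by omega)
    simp [he'] at he
  rcases hlt.eq_or_lt with heq | hlt
  · exact ⟨z, hz, by omega, fun e he => mul_self_pos.2 he⟩
  obtain ⟨S, hSz, hS⟩ := exists_subset_card_eq (s := univ.filter fun e => z e ≠ 0)
    (n := r + 1) (by omega)
  obtain ⟨u, hu, huS⟩ := hV.exists_dependence hS
  have hzS : ∀ e, u e ≠ 0 → z e ≠ 0 := fun e he => by simpa using hSz ((huS e).1 he)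
  obtain ⟨u, hu, huS, hzS, hpos⟩ : ∃ u, IsDependence V u ∧ (∀ e, u e ≠ 0 ↔ e ∈ S) ∧
      (∀ e, u e ≠ 0 → z e ≠ 0) ∧ ∃ e, 0 < u e * z e := by
    obtain ⟨e, he⟩ : S.Nonempty := card_pos.1 (by omega)
    have hue := (huS e).2 he
    rcases (mul_ne_zero hue (hzS e hue)).lt_or_gt with h | h
    · refine ⟨fun e => (-1) * u e + 0 * u e, hu.comb hu _ _, fun e => by simp [huS],
        fun e h' => hzS e (by simpa using h'), e, by simp only; linarith⟩
    · exact ⟨u, hu, huS, hzS, e, h⟩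
  -- The smallest ratio among the elements where `u` and `z` agree in sign is the first moment at
  -- which a coefficient of `z - λ u` vanishes; elements where they disagree only grow in absolute
  -- value.
  obtain ⟨f, hf, hmin⟩ := exists_min_image (univ.filter fun e => 0 < u e * z e)
    (fun e => z e / u e) (by obtain ⟨e, he⟩ := hpos; exact ⟨e, by simpa using he⟩)
  simp only [mem_filter, mem_univ, true_and] at hf hmin
  have huf : u f ≠ 0 := fun h => by simp [h] at hf
  have hlam : 0 < z f / u f := by
    rw [div_eq_mul_inv, ← mul_pos_iff_of_pos_right (mul_self_pos.2 huf)]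
    have : z f * (u f)⁻¹ * (u f * u f) = u f * z f := by field_simp
    rwa [this]
  -- An element of the support of `z` outside `S` is untouched, which keeps the new dependence
  -- nonzero.
  obtain ⟨g, hg, hgS⟩ : ∃ g, z g ≠ 0 ∧ g ∉ S := by
    by_contra! h
    have : (univ.filter fun e => z e ≠ 0) ⊆ S := fun e he => h e (by simpa using he)
    have := card_le_card this
    omega
  have hug : u g = 0 := by by_contra h; exact hgS ((huS g).1 h)
  set z' : E → ℝ := fun e => 1 * z e + (-(z f / u f)) * u e with hz'
  have hconf : ∀ e, z' e ≠ 0 → 0 < z' e * z e := by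
    intro e he
    by_cases hue : u e = 0
    · simp only [hz', hue, mul_zero, add_zero, one_mul] at he ⊢
      exact mul_self_pos.2 he
    have hze := mul_self_pos.2 (hzS e hue)
    rcases (mul_ne_zero hue (hzS e hue)).lt_or_gt with h | h
    · simp only [hz']; nlinarith
    · have h1 := hmin e h
      have h2 : z f / u f * (u e * z e) ≤ z e * z e := by
        calc _ ≤ z e / u e * (u e * z e) := by gcongr
          _ = _ := by field_simp
      have h3 : 0 ≤ z' e * z e := by simp only [hz']; nlinarith
      exact h3.lt_of_ne (mul_ne_zero he (hzS e hue)).symm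
  have hlt' : (univ.filter fun e => z' e ≠ 0).card < n := by
    rw [← hn]
    refine card_lt_card ⟨fun e he => ?_, fun h => ?_⟩
    · simp only [mem_filter, mem_univ, true_and] at he ⊢
      intro h
      have := hconf e he
      simp [h] at this
    · have h1 : f ∈ univ.filter fun e => z' e ≠ 0 := h (by simp [hzS f huf])
      simp [hz', huf] at h1
  obtain ⟨w, hw, hc, hconf'⟩ := ih _ hlt' z' (hz.comb hu _ _)
    (fun h => hg (by simpa [hz', hug] using congrFun h g)) rfl
  refine ⟨w, hw, hc, fun e he => ?_⟩
  have h1 := hconf' e he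
  have h2 := hconf e fun h => by simp [h] at h1
  have h3 : 0 < w e * z e * (z' e * z' e) := by nlinarith [mul_pos h1 h2]
  exact (pos_iff_pos_of_mul_pos h3).2 (mul_self_pos.2 fun h => by simp [h] at h1)

theorem SignVec.supp_sign (u : E → ℝ) :
    SignVec.supp (fun e => SignType.sign (u e)) = univ.filter fun e => u e ≠ 0 := by
  ext e; simp [SignVec.supp]

/-- The oriented matroid of a vector configuration in general position. -/
def OrientedMatroid.ofVectors (V : E → Fin r → ℝ) (hV : GeneralPosition V) :
    OrientedMatroid E where
  circuits := {X | ∃ u, IsDependence V u ∧ (univ.filter fun e => u e ≠ 0).card = r + 1 ∧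
    X = fun e => SignType.sign (u e)}
  zero_notMem := by
    rintro ⟨u, -, hc, h⟩
    have : (univ.filter fun e => u e ≠ 0) = ∅ := by
      rw [← SignVec.supp_sign, ← h]; simp [SignVec.supp]
    simp [this] at hc
  neg_mem := by
    rintro _ ⟨u, hu, hc, rfl⟩
    refine ⟨fun e => (-1) * u e + 0 * u e, hu.comb hu _ _, by simpa using hc, ?_⟩
    funext e
    simp [Left.sign_neg]
  incomparable := by
    classical
    rintro _ ⟨u, hu, hcu, rfl⟩ _ ⟨v, hv, hcv, rfl⟩ h
    simp only [SignVec.supp_sign] at h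
    have hs := eq_of_subset_of_card_le h (by omega)
    have huv : ∀ e, u e ≠ 0 ↔ v e ≠ 0 := fun e => by simpa using Finset.ext_iff.1 hs e
    obtain ⟨f, hf⟩ : (univ.filter fun e => u e ≠ 0).Nonempty := card_pos.1 (by omega)
    replace hf : u f ≠ 0 := by simpa using hf
    -- This combination cancels at `f`, so its support has at most `r` elements.
    have hzero : (fun e => v f * u e + (-u f) * v e) = 0 := by
      by_contra h0
      obtain ⟨e, he, he'⟩ := hV.exists_ne_zero_notMem (hu.comb hv (v f) (-u f)) h0
        (S := (univ.filter fun e => u e ≠ 0).erase f)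
        (by rw [card_erase_of_mem (by simpa using hf), hcu]; rfl)
      apply he'
      by_cases hef : e = f
      · subst hef; ring
      · have hue : u e = 0 := by simpa [hef] using he
        have hve : v e = 0 := by by_contra h; exact (huv e).2 h hue
        simp [hue, hve]
    have heq : ∀ e, u e = u f / v f * v e := fun e => by
      have := congrFun hzero e
      have hvf := (huv f).1 hf
      simp only [Pi.zero_apply] at this
      field_simp
      linarith
    rcases (div_ne_zero hf ((huv f).1 hf)).lt_or_gt with hl | hl
    · right
      funext e
      rw [heq e, sign_mul, sign_neg hl]; simp
    · left
      funext e
      rw [heq e, sign_mul, sign_pos hl, one_mul]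
  elimination := by
    rintro _ ⟨u, hu, hcu, rfl⟩ _ ⟨v, hv, hcv, rfl⟩ hne e hue hve
    replace hue : 0 < u e := sign_eq_one_iff.1 hue
    replace hve : v e < 0 := sign_eq_neg_one_iff.1 hve
    -- The coefficients `-v e` and `u e` are positive and the combination vanishes at `e`; it could
    -- vanish identically only if the two sign vectors were opposite. A conformal circuit of it is
    -- the required elimination.
    have hz0 : (fun k => (-v e) * u k + u e * v k) ≠ 0 := by
      intro h
      apply hne
      funext k
      have h1 : (-v e) * u k + u e * v k = 0 := congrFun h k
      have h2 : SignType.sign ((-v e) * u k) = SignType.sign (-(u e * v k)) := by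
        congr 1; linarith
      rw [sign_mul, Left.sign_neg (u e * v k), sign_mul, sign_pos hue,
        sign_pos (show 0 < -v e by linarith)] at h2
      simpa using h2
    obtain ⟨w, hw, hc, hconf⟩ := hV.exists_conformal _ (hu.comb hv (-v e) (u e)) hz0
    refine ⟨_, ⟨w, hw, hc, rfl⟩, ?_, fun f hf => ?_, fun f hf => ?_⟩
    · by_contra h
      have := hconf e (by simpa using h)
      simp [mul_comm] at this
    · replace hf : 0 < w f := sign_eq_one_iff.1 hf
      have h1 := pos_of_mul_pos_right (hconf f hf.ne') hf.le
      rw [sign_eq_one_iff, sign_eq_one_iff]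
      by_contra! h
      nlinarith [mul_nonneg (neg_nonneg.2 hve.le) (neg_nonneg.2 h.1),
        mul_nonneg hue.le (neg_nonneg.2 h.2)]
    · replace hf : w f < 0 := sign_eq_neg_one_iff.1 hf
      have h1 := neg_of_mul_pos_right (hconf f hf.ne) hf.le
      rw [sign_eq_neg_one_iff, sign_eq_neg_one_iff]
      by_contra! h
      nlinarith [mul_nonneg (neg_nonneg.2 hve.le) h.1, mul_nonneg hue.le h.2]

end Realizable

/-! ### Rank, uniformity and chirotope of a vector configuration -/

section Realizable

open Finset

variable {E : Type*} [Fintype E] {r : ℕ}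

namespace OrientedMatroid

theorem card_supp_ofVectors {V : E → Fin r → ℝ} (hV : GeneralPosition V) {X : E → SignType}
    (hX : X ∈ (ofVectors V hV).circuits) : (SignVec.supp X).card = r + 1 := by
  obtain ⟨u, -, hc, rfl⟩ := hX
  rw [SignVec.supp_sign, hc]

theorem indep_ofVectors_iff {V : E → Fin r → ℝ} (hV : GeneralPosition V) (S : Finset E) :
    (ofVectors V hV).Indep S ↔ S.card ≤ r := by
  classical
  refine ⟨fun h => ?_, fun h X hX hXS => ?_⟩
  · by_contra! hlt
    obtain ⟨T, hTS, hT⟩ := exists_subset_card_eq (n := r + 1) hlt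
    obtain ⟨u, hu, huT⟩ := hV.exists_dependence hT
    have hsupp : (univ.filter fun e => u e ≠ 0) = T := by ext e; simp [huT]
    refine h _ ⟨u, hu, by rw [hsupp, hT], rfl⟩ ?_
    rw [SignVec.supp_sign, hsupp]
    exact hTS
  · have := card_le_card hXS
    rw [card_supp_ofVectors hV hX] at this
    omega

theorem isUniform_ofVectors {V : E → Fin r → ℝ} (hV : GeneralPosition V) :
    (ofVectors V hV).IsUniform r := by
  refine ⟨⟨?_, ?_⟩, fun X hX => card_supp_ofVectors hV hX⟩
  · obtain ⟨S, -, hS⟩ := exists_subset_card_eq (s := (univ : Finset E)) (n := r) hV.1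
    exact ⟨S, (indep_ofVectors_iff hV S).2 hS.le, hS⟩
  · rintro _ ⟨S, hS, rfl⟩
    exact (indep_ofVectors_iff hV S).1 hS

/-- The chirotope of a vector configuration. -/
noncomputable def chirotopeOfVectors (V : E → Fin r → ℝ) (x : Fin r → E) : SignType :=
  SignType.sign (Matrix.of fun i => V (x i)).det

theorem chirotopeOfVectors_ne_zero_iff [DecidableEq E] {V : E → Fin r → ℝ}
    (hV : GeneralPosition V) (x : Fin r → E) :
    chirotopeOfVectors V x ≠ 0 ↔ Function.Injective x := by
  rw [chirotopeOfVectors, sign_ne_zero]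
  constructor
  · intro h i j hij
    by_contra hne
    exact h (Matrix.det_zero_of_row_eq hne (by ext k; simp [hij]))
  · intro hx
    have hli := hV.2 (univ.image x) (by rw [card_image_of_injective _ hx]; simp)
    rw [coe_image, coe_univ, Set.image_univ, linearIndepOn_range_iff hx] at hli
    have : LinearIndependent ℝ (Matrix.of fun i => V (x i)).row := hli
    rw [Matrix.linearIndependent_rows_iff_isUnit, Matrix.isUnit_iff_isUnit_det] at this
    exact this.ne_zero

theorem isChirotope_ofVectors [DecidableEq E] {V : E → Fin r → ℝ} (hV : GeneralPosition V) :
    (ofVectors V hV).IsChirotope r (chirotopeOfVectors V) where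
  hasRank := (isUniform_ofVectors hV).1
  alternating x i j hij := by
    have : (Matrix.of fun k => V ((x ∘ Equiv.swap i j) k)) =
        (Matrix.of fun k => V (x k)).submatrix (Equiv.swap i j) id := by
      ext; simp
    rw [chirotopeOfVectors, this, Matrix.det_permute, Equiv.Perm.sign_swap hij]
    simp [chirotopeOfVectors, Left.sign_neg]
  ne_zero_iff x := by
    rw [chirotopeOfVectors_ne_zero_iff hV, indep_ofVectors_iff hV, iff_self_and]
    intro _
    exact card_image_le.trans (by simp)
  exchange x i f X hX hf hsub hXi hXf := by
    obtain ⟨u, hu, hc, rfl⟩ := hX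
    simp only [SignVec.supp_sign] at hsub
    rw [sign_ne_zero] at hXi hXf
    have hcard := card_le_card hsub
    have hfim : f ∉ univ.image x := by
      intro h
      rw [insert_eq_of_mem h, hc] at hcard
      have := card_image_le (s := univ) (f := x)
      simp at this
      omega
    have hinj : Function.Injective x := by
      rw [card_insert_of_notMem hfim, hc] at hcard
      have h1 : (univ.image x).card = (univ : Finset (Fin r)).card :=
        le_antisymm card_image_le (by simp; omega)
      exact Set.injOn_univ.1 (by simpa using card_image_iff.1 h1)
    have hrel : u f • V f = ∑ k, (-u (x k)) • V (x k) := by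
      have h1 : ∑ e ∈ insert f (univ.image x), u e • V e = 0 := by
        rw [← hu]
        refine sum_subset (subset_univ _) fun e _ he => ?_
        have : u e = 0 := by
          by_contra h
          exact he (hsub (by simpa using h))
        rw [this, zero_smul]
      rw [sum_insert hfim, sum_image hinj.injOn] at h1
      simp only [neg_smul, sum_neg_distrib]
      exact eq_neg_of_add_eq_zero_left h1
    have hupd : (Matrix.of fun k => V (Function.update x i f k)) =
        (Matrix.of fun k => V (x k)).updateRow i (V f) := by
      ext k l
      by_cases hk : k = i
      · subst hk; simp
      · simp [hk, Matrix.updateRow_ne]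
    -- Cramer's rule: with row `i` replaced by the linear combination `hrel` of all rows, only the
    -- `i`-th summand contributes to the determinant.
    have hdet : u f * (Matrix.of fun k => V (Function.update x i f k)).det =
        -u (x i) * (Matrix.of fun k => V (x k)).det := by
      rw [hupd, ← Matrix.det_updateRow_smul, hrel]
      have := Matrix.det_updateRow_sum (Matrix.of fun k => V (x k)) i (fun k => -u (x k))
      rw [smul_eq_mul] at this
      exact this
    have hs := congrArg SignType.sign hdet
    rw [sign_mul, sign_mul, Left.sign_neg] at hs
    simp only [chirotopeOfVectors]
    have key : ∀ a b c d : SignType, a ≠ 0 → b ≠ 0 → a * c = -b * d → c = -(b * a * d) := by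
      decide
    exact key _ _ _ _ (sign_ne_zero.2 hXf) (sign_ne_zero.2 hXi) hs

end OrientedMatroid

end Realizable

/-! ### Vectors realising an arbitrary matrix of signs -/

section LawrenceVectors

open Finset

variable {r n : ℕ}

/-- Vectors whose maximal minors are dominated by their diagonal term. -/
noncomputable def lawrenceVectors (A : Matrix (Fin r) (Fin n) SignType) (e : Fin n) (i : Fin r) : ℝ :=
  (A i e : ℝ) * (r.factorial : ℝ) ^ ((i : ℕ) * (e : ℕ))

/-- The rearrangement inequality, strict because the values of `j` are distinct: equality would make
`σ` monotone, and the only monotone permutation of a finite chain is the identity. -/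
theorem sum_perm_mul_lt {j : Fin r → Fin n} (hj : StrictMono j) {σ : Equiv.Perm (Fin r)}
    (hσ : σ ≠ 1) : ∑ i, (σ i : ℕ) * (j i : ℕ) < ∑ i : Fin r, (i : ℕ) * (j i : ℕ) := by
  have hmono : Monovary (fun i : Fin r => (i : ℕ)) (fun i => (j i : ℕ)) := by
    intro a b h
    exact (hj.lt_iff_lt.1 h).le
  refine hmono.sum_comp_perm_mul_lt_sum_mul_iff.2 fun h => hσ ?_
  have hm : Monotone σ := by
    intro a b hab
    rcases hab.eq_or_lt with rfl | hab
    · exact le_rfl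
    · exact h (hj hab)
  have hs : StrictMono σ := hm.strictMono_of_injective σ.injective
  ext x
  exact congrArg Fin.val (DFunLike.congr_fun
    (Subsingleton.elim (hs.orderIsoOfSurjective σ σ.surjective) (OrderIso.refl _)) x)

/-- With `T = r!` the diagonal term of the Leibniz formula has absolute value `T ^ m`, and each of
the `T - 1` others is at most `T ^ (m - 1)`. Their sum is too small to change the sign. -/
theorem sign_det_lawrenceVectors {A : Matrix (Fin r) (Fin n) SignType} (hA : ∀ i j, A i j ≠ 0)
    {j : Fin r → Fin n} (hj : StrictMono j) :
    SignType.sign (Matrix.of fun i => lawrenceVectors A (j i)).det = ∏ i, A i (j i) := by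
  classical
  set T : ℝ := (r.factorial : ℝ) with hT
  have hT1 : 1 ≤ T := by rw [hT]; exact_mod_cast r.factorial_pos
  have habs : ∀ s : SignType, s ≠ 0 → |(s : ℝ)| = 1 := by
    intro s hs; cases s <;> simp_all
  set m := ∑ i : Fin r, (i : ℕ) * (j i : ℕ) with hm
  rw [← Matrix.det_transpose, Matrix.det_apply', ← add_sum_erase _ _ (mem_univ 1)]
  have hdiag : ∏ i, (Matrix.of fun i => lawrenceVectors A (j i)).transpose ((1 : Equiv.Perm (Fin r)) i) i =
      ((∏ i, A i (j i) : SignType) : ℝ) * T ^ m := by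
    simp only [Matrix.transpose_apply, Matrix.of_apply, lawrenceVectors, Equiv.Perm.one_apply,
      prod_mul_distrib, prod_pow_eq_pow_sum, hm]
    congr 1
    exact (map_prod (SignType.castHom : SignType →*₀ ℝ) _ _).symm
  have hoff : |∑ σ ∈ univ.erase (1 : Equiv.Perm (Fin r)), ((Equiv.Perm.sign σ : ℤ) : ℝ) *
      ∏ i, (Matrix.of fun i => lawrenceVectors A (j i)).transpose (σ i) i| < T ^ m := by
    calc _ ≤ ∑ σ ∈ univ.erase (1 : Equiv.Perm (Fin r)), T ^ (m - 1) := by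
          refine (abs_sum_le_sum_abs _ _).trans (sum_le_sum fun σ hσ => ?_)
          have hs : |((Equiv.Perm.sign σ : ℤ) : ℝ)| = 1 := by
            rcases Int.units_eq_one_or (Equiv.Perm.sign σ) with h | h <;> simp [h]
          rw [abs_mul, hs, one_mul, abs_prod]
          simp only [Matrix.transpose_apply, Matrix.of_apply, lawrenceVectors, abs_mul,
            habs _ (hA _ _), one_mul, abs_pow, ← hT, abs_of_nonneg (zero_le_one.trans hT1),
            prod_pow_eq_pow_sum]
          apply pow_le_pow_right₀ hT1
          have := sum_perm_mul_lt hj (ne_of_mem_erase hσ)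
          omega
      _ = (T - 1) * T ^ (m - 1) := by
          rw [sum_const, card_erase_of_mem (mem_univ _), card_univ, Fintype.card_perm,
            Fintype.card_fin, nsmul_eq_mul, Nat.cast_sub r.factorial_pos, hT, Nat.cast_one]
      _ < T ^ m := by
          rcases Nat.eq_zero_or_pos m with h0 | h0
          -- Here `m - 1` is truncated to `0`. But `m = 0` forces `r ≤ 1`, and then there are no
          -- off-diagonal terms.
          · have hr : T = 1 := by
              by_contra hne
              have : ¬ r ≤ 1 := by
                intro h
                apply hne
                rw [hT, Nat.factorial_eq_one.2 h, Nat.cast_one]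
              have h1 : 0 < m := by
                rw [hm]
                refine sum_pos' (fun _ _ => Nat.zero_le _) ⟨⟨1, by omega⟩, mem_univ _, ?_⟩
                have : j ⟨0, by omega⟩ < j ⟨1, by omega⟩ := hj (by simp [Fin.lt_def])
                rw [Fin.lt_def] at this
                simp only [one_mul]
                omega
              omega
            simp [hr]
          · obtain ⟨k, hk⟩ : ∃ k, m = k + 1 := ⟨m - 1, by omega⟩
            rw [hk, pow_succ, mul_comm (T ^ k)]
            have : 0 < T ^ k := by positivity
            simp only [Nat.add_sub_cancel]
            nlinarith
  rw [hdiag]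
  simp only [Equiv.Perm.sign_one, Units.val_one, Int.cast_one, one_mul]
  have hne : ∏ i, A i (j i) ≠ 0 := prod_ne_zero_iff.2 fun i _ => hA i _
  rw [abs_lt] at hoff
  generalize ∏ i, A i (j i) = s at hne ⊢
  cases s
  · exact absurd rfl hne
  · simp only [SignType.neg_eq_neg_one, SignType.coe_neg_one]
    exact sign_neg (by linarith [hoff.2])
  · simp only [SignType.pos_eq_one, SignType.coe_one]
    exact sign_pos (by linarith [hoff.1])

theorem generalPosition_lawrenceVectors (hrn : r ≤ n) {A : Matrix (Fin r) (Fin n) SignType}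
    (hA : ∀ i j, A i j ≠ 0) : GeneralPosition (lawrenceVectors A) := by
  refine ⟨by simpa using hrn, fun S hS => ?_⟩
  have h := sign_det_lawrenceVectors hA (S.orderEmbOfFin hS).strictMono
  have hne : ∏ i, A i (S.orderEmbOfFin hS i) ≠ 0 := prod_ne_zero_iff.2 fun i _ => hA i _
  rw [← h, sign_ne_zero] at hne
  have hli : LinearIndependent ℝ
      (Matrix.of fun i => lawrenceVectors A (S.orderEmbOfFin hS i)).row := by
    rw [Matrix.linearIndependent_rows_iff_isUnit, Matrix.isUnit_iff_isUnit_det]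
    exact isUnit_iff_ne_zero.2 hne
  have hrange : (S : Set (Fin n)) = Set.range (S.orderEmbOfFin hS) := by simp
  rw [hrange, linearIndepOn_range_iff (S.orderEmbOfFin hS).injective]
  exact hli

/-- The Lawrence oriented matroid of a matrix of signs. -/
noncomputable def OrientedMatroid.lawrence (hrn : r ≤ n) (A : Matrix (Fin r) (Fin n) SignType)
    (hA : ∀ i j, A i j ≠ 0) : OrientedMatroid (Fin n) :=
  OrientedMatroid.ofVectors (lawrenceVectors A) (generalPosition_lawrenceVectors hrn hA)

end LawrenceVectors

/-! ### The circuits of a Lawrence oriented matroid in terms of its matrix -/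

section LawrenceCircuits

open Finset

variable {r n : ℕ}

/-- The sign vectors that a matrix of signs prescribes as circuits of its Lawrence oriented
matroid: row `i` compares the `i`-th and the `(i + 1)`-st element of the support. -/
def lawrenceCircuits (A : Matrix (Fin r) (Fin n) SignType) : Set (Fin n → SignType) :=
  {X | ∃ j : Fin (r + 1) → Fin n, StrictMono j ∧ (∀ e, X e ≠ 0 ↔ e ∈ Set.range j) ∧
    ∀ i : Fin r, X (j i.succ) = -(A i (j i.castSucc) * A i (j i.succ) * X (j i.castSucc))}

namespace OrientedMatroid

theorem IsUniform.exists_circuit {E : Type*} [Fintype E] {M : OrientedMatroid E}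
    (hM : M.IsUniform r) {j : Fin (r + 1) → E} (hj : Function.Injective j) :
    ∃ X ∈ M.circuits, ∀ e, X e ≠ 0 ↔ e ∈ Set.range j := by
  classical
  have hcard : (univ.image j).card = r + 1 := by rw [card_image_of_injective _ hj]; simp
  have hdep : ¬ M.Indep (univ.image j) := fun h => by
    have := hM.1.2 ⟨_, h, hcard⟩
    omega
  obtain ⟨X, hX, hsub⟩ : ∃ X ∈ M.circuits, SignVec.supp X ⊆ univ.image j := by
    simpa [Indep] using hdep
  have heq := eq_of_subset_of_card_le hsub (by rw [hM.2 X hX, hcard])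
  exact ⟨X, hX, fun e => by simpa [SignVec.supp] using Finset.ext_iff.1 heq e⟩

/-- Compare the bases obtained from the support by deleting `j (i + 1)` and by deleting `j i`. Both
are increasing and differ only in position `i`, so the products giving `χ` share all factors except
that of row `i`, and the exchange rule leaves the stated relation. -/
theorem IsChirotope.circuit_step {M : OrientedMatroid (Fin n)} {χ : (Fin r → Fin n) → SignType}
    (hχ : M.IsChirotope r χ) {A : Matrix (Fin r) (Fin n) SignType} (hA : ∀ i j, A i j ≠ 0)
    (hAχ : ∀ j : Fin r → Fin n, StrictMono j → χ j = ∏ i, A i (j i))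
    {X : Fin n → SignType} (hX : X ∈ M.circuits) {j : Fin (r + 1) → Fin n} (hj : StrictMono j)
    (hXj : ∀ e, X e ≠ 0 ↔ e ∈ Set.range j) (i : Fin r) :
    X (j i.succ) = -(A i (j i.castSucc) * A i (j i.succ) * X (j i.castSucc)) := by
  set x : Fin r → Fin n := j ∘ i.succ.succAbove with hx
  have hxi : x i = j i.castSucc := by
    rw [hx, Function.comp, Fin.succAbove_succ_of_le _ _ le_rfl]
  have hupd : Function.update x i (j i.succ) = j ∘ i.castSucc.succAbove := by
    funext k
    rcases lt_trichotomy k i with h | rfl | h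
    · rw [Function.update_of_ne h.ne, hx, Function.comp, Function.comp,
        Fin.succAbove_succ_of_le _ _ h.le, Fin.succAbove_castSucc_of_lt _ _ h]
    · rw [Function.update_self, Function.comp, Fin.succAbove_castSucc_of_le _ _ le_rfl]
    · rw [Function.update_of_ne h.ne', hx, Function.comp, Function.comp,
        Fin.succAbove_succ_of_lt _ _ h, Fin.succAbove_castSucc_of_le _ _ h.le]
  have hex := hχ.exchange x i (j i.succ) X hX
    (by rw [hxi]; exact (hj (Fin.castSucc_lt_succ)).ne')
    (by
      intro e he
      obtain ⟨k, rfl⟩ := (hXj e).1 (by simpa [SignVec.supp] using he)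
      by_cases hk : k = i.succ
      · simp [hk]
      · obtain ⟨l, rfl⟩ := Fin.exists_succAbove_eq hk
        simp [hx])
    (by rw [hxi, hXj]; exact ⟨_, rfl⟩) ((hXj _).2 ⟨_, rfl⟩)
  rw [hAχ x (hj.comp (Fin.strictMono_succAbove _)), hupd,
    hAχ _ (hj.comp (Fin.strictMono_succAbove _)), ← hupd, hxi,
    ← mul_prod_erase univ _ (mem_univ i), ← mul_prod_erase univ (fun k => A k (x k)) (mem_univ i),
    prod_congr rfl (fun k hk => by
      rw [Function.update_of_ne (ne_of_mem_erase hk)] :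
      ∀ k ∈ univ.erase i, A k (Function.update x i (j i.succ) k) = A k (x k)),
    Function.update_self, hxi] at hex
  have hne : ∏ k ∈ univ.erase i, A k (x k) ≠ 0 := prod_ne_zero_iff.2 fun k _ => hA k _
  have key : ∀ a b p s t : SignType, a ≠ 0 → b ≠ 0 → p ≠ 0 → s ≠ 0 → t ≠ 0 →
      b * p = -(s * t * (a * p)) → t = -(a * b * s) := by decide
  exact key _ _ _ _ _ (hA _ _) (hA _ _) hne ((hXj _).2 ⟨_, rfl⟩) ((hXj _).2 ⟨_, rfl⟩) hex

end OrientedMatroid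

/-- The steps propagate the first sign along the whole support, so only that sign is free. -/
theorem eq_or_eq_neg_of_lawrence_step {A : Matrix (Fin r) (Fin n) SignType}
    {j : Fin (r + 1) → Fin n} {X Y : Fin n → SignType}
    (hX : ∀ e, X e ≠ 0 ↔ e ∈ Set.range j) (hY : ∀ e, Y e ≠ 0 ↔ e ∈ Set.range j)
    (hXs : ∀ i : Fin r, X (j i.succ) = -(A i (j i.castSucc) * A i (j i.succ) * X (j i.castSucc)))
    (hYs : ∀ i : Fin r, Y (j i.succ) = -(A i (j i.castSucc) * A i (j i.succ) * Y (j i.castSucc))) :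
    X = Y ∨ X = -Y := by
  have key : ∀ s t : SignType, s ≠ 0 → t ≠ 0 → ∃ c : SignType, (c = 1 ∨ c = -1) ∧ s = c * t := by
    decide
  obtain ⟨c, hc, h0⟩ := key (X (j 0)) (Y (j 0)) ((hX _).2 ⟨_, rfl⟩) ((hY _).2 ⟨_, rfl⟩)
  have hall : ∀ k, X (j k) = c * Y (j k) := by
    intro k
    induction k using Fin.induction with
    | zero => exact h0
    | succ i ih => rw [hXs, hYs, ih, mul_neg]; congr 1; exact mul_left_comm _ _ _
  have hXY : X = fun e => c * Y e := by
    funext e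
    by_cases he : e ∈ Set.range j
    · obtain ⟨k, rfl⟩ := he; exact hall k
    · rw [not_not.1 (mt (hX e).1 he), not_not.1 (mt (hY e).1 he), mul_zero]
  rcases hc with rfl | rfl
  · left; simpa using hXY
  · right; rw [hXY]; funext e; simp

namespace OrientedMatroid

/-- For the reverse inclusion, uniformity provides some circuit on the prescribed support, and it
agrees with the prescribed vector up to sign. -/
theorem IsUniform.circuits_eq_lawrenceCircuits {M : OrientedMatroid (Fin n)} (hM : M.IsUniform r)
    {A : Matrix (Fin r) (Fin n) SignType} (hA : ∀ i j, A i j ≠ 0)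
    {χ : (Fin r → Fin n) → SignType} (hχ : M.IsChirotope r χ)
    (hAχ : ∀ j : Fin r → Fin n, StrictMono j → χ j = ∏ i, A i (j i)) :
    M.circuits = lawrenceCircuits A := by
  ext X
  constructor
  · intro hX
    have hr : ∀ e, X e ≠ 0 ↔ e ∈ Set.range ((SignVec.supp X).orderEmbOfFin (hM.2 X hX)) := by
      intro e; simp [SignVec.supp]
    exact ⟨_, ((SignVec.supp X).orderEmbOfFin (hM.2 X hX)).strictMono, hr,
      hχ.circuit_step hA hAχ hX (OrderEmbedding.strictMono _) hr⟩
  · rintro ⟨j, hj, hXj, hstep⟩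
    obtain ⟨Y, hY, hYj⟩ := hM.exists_circuit hj.injective
    rcases eq_or_eq_neg_of_lawrence_step hXj hYj hstep
      (hχ.circuit_step hA hAχ hY hj hYj) with h | h
    · rwa [h]
    · rw [h]; exact M.neg_mem Y hY

theorem isChirotope_lawrence (hrn : r ≤ n) (A : Matrix (Fin r) (Fin n) SignType)
    (hA : ∀ i j, A i j ≠ 0) :
    (lawrence hrn A hA).IsChirotope r (chirotopeOfVectors (lawrenceVectors A)) :=
  isChirotope_ofVectors _

theorem isLawrence_lawrence (hrn : r ≤ n) (A : Matrix (Fin r) (Fin n) SignType)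
    (hA : ∀ i j, A i j ≠ 0) : (lawrence hrn A hA).IsLawrence r :=
  ⟨isUniform_ofVectors _, A, _, hA, isChirotope_lawrence hrn A hA,
    fun _ hj => sign_det_lawrenceVectors hA hj⟩

theorem circuits_lawrence (hrn : r ≤ n) (A : Matrix (Fin r) (Fin n) SignType)
    (hA : ∀ i j, A i j ≠ 0) : (lawrence hrn A hA).circuits = lawrenceCircuits A :=
  (isUniform_ofVectors _).circuits_eq_lawrenceCircuits hA (isChirotope_lawrence hrn A hA)
    fun _ hj => sign_det_lawrenceVectors hA hj

theorem IsLawrence.exists_circuits_eq {M : OrientedMatroid (Fin n)} (hM : M.IsLawrence r) :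
    ∃ A : Matrix (Fin r) (Fin n) SignType, (∀ i j, A i j ≠ 0) ∧
      M.circuits = lawrenceCircuits A := by
  obtain ⟨hU, A, χ, hA, hχ, h⟩ := hM
  exact ⟨A, hA, hU.circuits_eq_lawrenceCircuits hA hχ h⟩

/-- The sign by which the reorientation of `R` multiplies the entry at `e`. -/
def reorientSign (R : Finset (Fin n)) (e : Fin n) : SignType := if e ∈ R then -1 else 1

theorem circuits_reorient {M : OrientedMatroid (Fin n)} {A : Matrix (Fin r) (Fin n) SignType}
    (hM : M.circuits = lawrenceCircuits A) (R : Finset (Fin n)) :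
    (M.reorient R).circuits = lawrenceCircuits (fun i e => reorientSign R e * A i e) := by
  have hflip : ∀ (X : Fin n → SignType) e, SignVec.flip R X e = reorientSign R e * X e := by
    intro X e
    by_cases h : e ∈ R <;> simp [SignVec.flip, reorientSign, h]
  have hsq : ∀ e, reorientSign R e = 1 ∨ reorientSign R e = -1 := by
    intro e
    by_cases h : e ∈ R <;> simp [reorientSign, h]
  have key : ∀ a b c d x y : SignType, (c = 1 ∨ c = -1) → (d = 1 ∨ d = -1) →
      (d * y = -(c * a * (d * b) * (c * x)) ↔ y = -(a * b * x)) := by decide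
  have hmem : ∀ X, SignVec.flip R X ∈ lawrenceCircuits (fun i e => reorientSign R e * A i e) ↔
      X ∈ lawrenceCircuits A := by
    intro X
    simp only [lawrenceCircuits, Set.mem_ofPred_eq, ne_eq, SignVec.flip_apply_eq_zero]
    simp only [hflip, key _ _ _ _ _ _ (hsq _) (hsq _)]
  ext X
  constructor
  · rintro ⟨Y, hY, rfl⟩
    rw [hmem, ← hM]
    exact hY
  · intro hX
    rw [← SignVec.flip_flip R X, hmem, ← hM] at hX
    exact ⟨_, hX, SignVec.flip_flip R X⟩

/-! ### Reorientation classes and invariance of the count -/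

theorem reorient_empty {E : Type*} [Fintype E] [DecidableEq E] (M : OrientedMatroid E) :
    M.reorient ∅ = M := by
  have : ∀ X : E → SignType, SignVec.flip ∅ X = X := fun X => by funext e; simp [SignVec.flip]
  ext X
  simp [reorient, this]

theorem reorient_reorient {E : Type*} [Fintype E] [DecidableEq E] (M : OrientedMatroid E)
    (R S : Finset E) : (M.reorient R).reorient S = M.reorient (symmDiff R S) := by
  have : ∀ X : E → SignType, SignVec.flip S (SignVec.flip R X) = SignVec.flip (symmDiff R S) X := by
    intro X
    funext e
    by_cases h1 : e ∈ R <;> by_cases h2 : e ∈ S <;>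
      simp [SignVec.flip, h1, h2, mem_symmDiff]
  ext X
  simp [reorient, this]

theorem reorientationClass_reorient {E : Type*} [Fintype E] [DecidableEq E]
    (M : OrientedMatroid E) (R : Finset E) :
    (M.reorient R).reorientationClass = M.reorientationClass := by
  ext N
  constructor
  · rintro ⟨S, rfl⟩
    exact ⟨_, (M.reorient_reorient R S).symm⟩
  · rintro ⟨S, rfl⟩
    refine ⟨symmDiff R S, ?_⟩
    rw [reorient_reorient, symmDiff_symmDiff_cancel_left]

theorem self_mem_reorientationClass {E : Type*} [Fintype E] [DecidableEq E]
    (M : OrientedMatroid E) : M ∈ M.reorientationClass := ⟨∅, M.reorient_empty⟩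

theorem mem_reorientationClass_iff {E : Type*} [Fintype E] [DecidableEq E]
    (M N : OrientedMatroid E) :
    M ∈ N.reorientationClass ↔ M.reorientationClass = N.reorientationClass := by
  constructor
  · rintro ⟨R, rfl⟩
    exact N.reorientationClass_reorient R
  · intro h
    rw [← h]
    exact M.self_mem_reorientationClass

theorem neighborlyCount_reorient {E : Type*} [Fintype E] [DecidableEq E]
    (M : OrientedMatroid E) (R : Finset E) (k : ℕ) :
    (M.reorient R).neighborlyCount k = M.neighborlyCount k := by
  unfold neighborlyCount
  refine Set.ncard_congr (fun S _ => symmDiff R S) ?_ ?_ ?_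
  · intro S hS
    simpa [reorient_reorient] using hS
  · intro S T _ _ h
    exact symmDiff_right_injective R h
  · intro S hS
    refine ⟨symmDiff R S, ?_, symmDiff_symmDiff_cancel_left R S⟩
    simpa [reorient_reorient, symmDiff_symmDiff_cancel_left] using hS

theorem neighborlyCount_eq_of_reorientationClass_eq {E : Type*} [Fintype E] [DecidableEq E]
    {M N : OrientedMatroid E} (h : M.reorientationClass = N.reorientationClass) (k : ℕ) :
    M.neighborlyCount k = N.neighborlyCount k := by
  obtain ⟨R, rfl⟩ := (mem_reorientationClass_iff M N).2 h
  exact N.neighborlyCount_reorient R k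

/-- The circuits of the alternating oriented matroid are prescribed by the all-one matrix. -/
theorem circuits_alternating : (alternating r n).circuits =
    lawrenceCircuits (fun (_ : Fin r) (_ : Fin n) => (1 : SignType)) := by
  ext X
  constructor
  · rintro ⟨hc, halt⟩
    have hr : ∀ e, X e ≠ 0 ↔ e ∈ Set.range ((SignVec.supp X).orderEmbOfFin hc) := by
      intro e; simp [SignVec.supp]
    refine ⟨_, ((SignVec.supp X).orderEmbOfFin hc).strictMono, hr, fun i => ?_⟩
    rw [one_mul, one_mul]
    refine halt _ _ ((OrderEmbedding.strictMono _) Fin.castSucc_lt_succ) ((hr _).2 ⟨_, rfl⟩)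
      ((hr _).2 ⟨_, rfl⟩) fun l h1 h2 => ?_
    by_contra h
    obtain ⟨k, rfl⟩ := (hr l).1 h
    rw [OrderEmbedding.lt_iff_lt] at h1 h2
    simp only [Fin.lt_def, Fin.val_castSucc, Fin.val_succ] at h1 h2
    omega
  · rintro ⟨j, hj, hXj, hstep⟩
    refine ⟨?_, fun a b hab ha hb h => ?_⟩
    · have : SignVec.supp X = univ.image j := by
        ext e; simp only [SignVec.supp, mem_filter, mem_univ, true_and, hXj, mem_image]; rfl
      rw [this, card_image_of_injective _ hj.injective]; simp
    · obtain ⟨k, rfl⟩ := (hXj a).1 ha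
      obtain ⟨l, rfl⟩ := (hXj b).1 hb
      have hkl : k < l := hj.lt_iff_lt.1 hab
      obtain ⟨i, rfl⟩ : ∃ i : Fin r, k = i.castSucc :=
        ⟨⟨k, by have := l.2; simp only [Fin.lt_def] at hkl; omega⟩, rfl⟩
      have hl : l = i.succ := by
        by_contra hne
        have h1 : i.succ < l := lt_of_le_of_ne (Fin.castSucc_lt_iff_succ_le.1 hkl) (Ne.symm hne)
        exact (hXj _).2 ⟨_, rfl⟩ (h _ (hj Fin.castSucc_lt_succ) (hj h1))
      subst hl
      simpa using hstep i

end OrientedMatroid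

end LawrenceCircuits

/-! ### Encoding a matrix by the sign changes along its rows -/

section SignDifferences

open Finset

/-- The exclusive or of the first `k` values of `d`. -/
def xorAccum (d : ℕ → Bool) : ℕ → Bool
  | 0 => false
  | k + 1 => xorAccum d k ^^ d k

theorem xorAccum_congr {d d' : ℕ → Bool} {k : ℕ} (h : ∀ t < k, d t = d' t) :
    xorAccum d k = xorAccum d' k := by
  induction k with
  | zero => rfl
  | succ k ih => rw [xorAccum, xorAccum, ih fun t ht => h t (by omega), h k (by omega)]

/-- The sign `-1` for `true` and `1` for `false`. -/
def boolSign (b : Bool) : SignType := if b then -1 else 1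

theorem boolSign_ne_zero (b : Bool) : boolSign b ≠ 0 := by cases b <;> decide

/-- The matrix of signs whose row `i` starts at column `i` with `1` and changes sign between the
columns `i + t` and `i + t + 1` if `D i t`. -/
def signMatrix (r n : ℕ) (D : ℕ → ℕ → Bool) : Matrix (Fin r) (Fin n) SignType :=
  fun i c => boolSign (xorAccum (D i) (c - i))

theorem signMatrix_ne_zero {r n : ℕ} (D : ℕ → ℕ → Bool) (i : Fin r) (c : Fin n) :
    signMatrix r n D i c ≠ 0 := boolSign_ne_zero _

variable {r w : ℕ}

theorem le_of_strictMono_fin {j : Fin (r + 1) → Fin (r + w + 1)} (hj : StrictMono j)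
    (k : Fin (r + 1)) : (k : ℕ) ≤ j k ∧ (j k : ℕ) ≤ k + w := by
  constructor
  · induction k using Fin.induction with
    | zero => simp
    | succ i ih =>
      have := hj (Fin.castSucc_lt_succ (i := i))
      simp only [Fin.lt_def, Fin.val_castSucc, Fin.val_succ] at this ih ⊢
      omega
  · induction k using Fin.reverseInduction with
    | last => have := (j (Fin.last r)).2; simp only [Fin.val_last]; omega
    | cast i ih =>
      have := hj (Fin.castSucc_lt_succ (i := i))
      simp only [Fin.lt_def, Fin.val_castSucc, Fin.val_succ] at this ih ⊢
      omega

/-- The `i`-th smallest of `r + 1` among `r + w + 1` elements lies between `i` and `i + w`, so row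
`i` is read only in columns `i, …, i + w + 1`, and only through products of two entries. A row may
therefore be normalised to begin with `1`. -/
theorem lawrenceCircuits_congr {A A' : Matrix (Fin r) (Fin (r + w + 1)) SignType}
    (h : ∀ (i : Fin r) (c c' : Fin (r + w + 1)), (i : ℕ) ≤ c → c < c' → (c' : ℕ) ≤ i + w + 1 →
      A i c * A i c' = A' i c * A' i c') :
    lawrenceCircuits A = lawrenceCircuits A' := by
  ext X
  refine exists_congr fun j => and_congr_right fun hj => and_congr_right fun _ =>
    forall_congr' fun i => ?_
  have h1 := le_of_strictMono_fin hj i.castSucc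
  have h2 := le_of_strictMono_fin hj i.succ
  simp only [Fin.val_castSucc, Fin.val_succ] at h1 h2
  rw [h i _ _ h1.1 (hj Fin.castSucc_lt_succ) (by omega)]

theorem lawrenceCircuits_signMatrix_congr {D D' : ℕ → ℕ → Bool}
    (h : ∀ i < r, ∀ t ≤ w, D i t = D' i t) :
    lawrenceCircuits (signMatrix r (r + w + 1) D) =
      lawrenceCircuits (signMatrix r (r + w + 1) D') := by
  refine lawrenceCircuits_congr fun i c c' hc hcc hc' => ?_
  have hcc' : (c : ℕ) < c' := hcc
  unfold signMatrix
  rw [xorAccum_congr (k := c - i) fun t ht => h i i.2 t (by omega),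
    xorAccum_congr (k := c' - i) fun t ht => h i i.2 t (by omega)]

theorem boolSign_xor (a b : Bool) : boolSign (a ^^ b) = boolSign a * boolSign b := by
  cases a <;> cases b <;> decide

theorem exists_lawrenceCircuits_eq_signMatrix {A : Matrix (Fin r) (Fin (r + w + 1)) SignType}
    (hA : ∀ i j, A i j ≠ 0) :
    ∃ D, lawrenceCircuits A = lawrenceCircuits (signMatrix r (r + w + 1) D) := by
  refine ⟨fun i t => if h : i < r ∧ i + t + 1 < r + w + 1 then
    decide (A ⟨i, h.1⟩ ⟨i + t, by omega⟩ ≠ A ⟨i, h.1⟩ ⟨i + t + 1, h.2⟩) else false, ?_⟩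
  set D : ℕ → ℕ → Bool := fun i t => if h : i < r ∧ i + t + 1 < r + w + 1 then
    decide (A ⟨i, h.1⟩ ⟨i + t, by omega⟩ ≠ A ⟨i, h.1⟩ ⟨i + t + 1, h.2⟩) else false with hD
  have key : ∀ (i : Fin r) (t : ℕ) (ht : i + t < r + w + 1), A i ⟨i + t, ht⟩ =
      A i ⟨i, by omega⟩ * boolSign (xorAccum (D i) t) := by
    intro i t
    induction t with
    | zero => intro ht; simp [xorAccum, boolSign]
    | succ t ih =>
      intro ht
      have h1 := ih (by omega)
      rw [xorAccum, boolSign_xor, ← mul_assoc, ← h1]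
      have h2 : D i t = decide (A i ⟨i + t, by omega⟩ ≠ A i ⟨i + t + 1, ht⟩) := by
        simp only [hD]
        rw [dif_pos ⟨i.2, ht⟩]
      rw [h2]
      have : ∀ a b : SignType, a ≠ 0 → b ≠ 0 → b = a * boolSign (decide (a ≠ b)) := by decide
      exact this _ _ (hA _ _) (hA _ _)
  refine lawrenceCircuits_congr fun i c c' hc hcc hc' => ?_
  have hcc' : (c : ℕ) < c' := hcc
  have key' : ∀ c : Fin (r + w + 1), (i : ℕ) ≤ c →
      A i c = A i ⟨i, by omega⟩ * signMatrix r (r + w + 1) D i c := fun c hc => by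
    have h := key i (c - i) (by omega)
    rwa [show (⟨i + (c - i), by omega⟩ : Fin (r + w + 1)) = c from Fin.ext (by simp; omega)] at h
  rw [key' c hc, key' c' (by omega)]
  have hsq : ∀ a b c : SignType, a ≠ 0 → a * b * (a * c) = b * c := by decide
  exact hsq _ _ _ (hA _ _)

/-- The sign differences that the reorientation of `R` produces between neighbouring elements. -/
def reorientDiff {n : ℕ} (R : Finset (Fin n)) (c : ℕ) : Bool :=
  decide (∃ e ∈ R, (e : ℕ) = c) ^^ decide (∃ e ∈ R, (e : ℕ) = c + 1)

/-- Changing the sign of column `c` toggles the sign changes on both of its sides. The effect on `D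
i t` depends only on the pair of columns `i + t`, `i + t + 1`, hence only on `i + t`. -/
theorem circuits_reorient_signMatrix {M : OrientedMatroid (Fin (r + w + 1))} {D : ℕ → ℕ → Bool}
    (hM : M.circuits = lawrenceCircuits (signMatrix r (r + w + 1) D))
    (R : Finset (Fin (r + w + 1))) :
    (M.reorient R).circuits = lawrenceCircuits
      (signMatrix r (r + w + 1) fun i t => D i t ^^ reorientDiff R (i + t)) := by
  rw [OrientedMatroid.circuits_reorient hM]
  refine lawrenceCircuits_congr fun i c c' hc hcc hc' => ?_
  have hcc' : (c : ℕ) < c' := hcc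
  set m : ℕ → Bool := fun c => decide (∃ e ∈ R, (e : ℕ) = c) with hm
  have hacc : ∀ i t, xorAccum (fun t => D i t ^^ reorientDiff R (i + t)) t =
      (xorAccum (D i) t ^^ (m i ^^ m (i + t))) := by
    intro i t
    induction t with
    | zero => simp [xorAccum]
    | succ t ih =>
      have : reorientDiff R (i + t) = (m (i + t) ^^ m (i + t + 1)) := rfl
      rw [xorAccum, ih, xorAccum, this, ← add_assoc]
      generalize m i = a
      generalize m (i + t) = b
      generalize m (i + t + 1) = c
      generalize xorAccum (D i) t = d
      generalize D i t = e
      revert a b c d e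
      decide
  have hs : ∀ e, OrientedMatroid.reorientSign R e = boolSign (m e) := by
    intro e
    have : (∃ e' ∈ R, (e' : ℕ) = e) ↔ e ∈ R :=
      ⟨fun ⟨e', h1, h2⟩ => Fin.ext h2 ▸ h1, fun h => ⟨e, h, rfl⟩⟩
    simp only [OrientedMatroid.reorientSign, boolSign, hm, this, decide_eq_true_eq]
  simp only [signMatrix, hacc, hs, show (i : ℕ) + (c - i) = c by omega,
    show (i : ℕ) + (c' - i) = c' by omega]
  generalize m i = a
  generalize m c = b
  generalize m c' = d
  generalize xorAccum (D i) (c - i) = e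
  generalize xorAccum (D i) (c' - i) = f
  revert a b d e f
  decide

theorem exists_mem_lawrenceCircuits {n : ℕ} (hrn : r ≤ n) {A : Matrix (Fin r) (Fin n) SignType}
    (hA : ∀ i j, A i j ≠ 0) {j : Fin (r + 1) → Fin n} (hj : StrictMono j) :
    ∃ X ∈ lawrenceCircuits A, ∀ e, X e ≠ 0 ↔ e ∈ Set.range j := by
  rw [← OrientedMatroid.circuits_lawrence hrn A hA]
  exact (OrientedMatroid.isLawrence_lawrence hrn A hA).1.exists_circuit hj.injective

theorem step_of_mem_lawrenceCircuits {n : ℕ} {A : Matrix (Fin r) (Fin n) SignType}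
    {X : Fin n → SignType} (hX : X ∈ lawrenceCircuits A) {j : Fin (r + 1) → Fin n}
    (hj : StrictMono j) (hXj : ∀ e, X e ≠ 0 ↔ e ∈ Set.range j) (i : Fin r) :
    X (j i.succ) = -(A i (j i.castSucc) * A i (j i.succ) * X (j i.castSucc)) := by
  obtain ⟨j', hj', hXj', h⟩ := hX
  have : j' = j := (hj'.range_inj hj).1 (by ext e; rw [← hXj, ← hXj'])
  exact this ▸ h i

/-- On the interval `t, …, t + r` row `i` compares the adjacent columns `i + t` and `i + t + 1`, so
this one circuit reveals `D i t`. -/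
theorem eq_of_lawrenceCircuits_signMatrix_eq {D D' : ℕ → ℕ → Bool}
    (h : lawrenceCircuits (signMatrix r (r + w + 1) D) =
      lawrenceCircuits (signMatrix r (r + w + 1) D')) {i t : ℕ} (hi : i < r) (ht : t ≤ w) :
    D i t = D' i t := by
  set j : Fin (r + 1) → Fin (r + w + 1) := fun k => ⟨k + t, by omega⟩ with hj
  have hjm : StrictMono j := fun a b hab => by
    simp only [hj, Fin.lt_def] at hab ⊢; omega
  obtain ⟨X, hX, hXj⟩ := exists_mem_lawrenceCircuits (by omega)
    (signMatrix_ne_zero (r := r) (n := r + w + 1) D) hjm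
  have h1 := step_of_mem_lawrenceCircuits hX hjm hXj ⟨i, hi⟩
  have h2 := step_of_mem_lawrenceCircuits (h ▸ hX) hjm hXj ⟨i, hi⟩
  rw [h1] at h2
  have hne : X (j (Fin.castSucc ⟨i, hi⟩)) ≠ 0 := (hXj _).2 ⟨_, rfl⟩
  simp only [signMatrix, hj, Fin.succ_mk, Fin.castSucc_mk,
    show i + 1 + t - i = t + 1 by omega, Nat.add_sub_cancel_left, xorAccum] at h2 hne
  revert h2 hne
  generalize xorAccum (D i) t = a
  generalize xorAccum (D' i) t = b
  generalize D i t = c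
  generalize D' i t = d
  generalize X _ = x
  revert a b c d x
  decide

/-! ### Neighborliness as a condition on paths of offsets -/

/-- Whether row `d` has different signs at the offsets `p` and `q + 1`. -/
def signChange (d : ℕ → Bool) (p q : ℕ) : Bool := xorAccum d (q + 1) ^^ xorAccum d p

/-- Some circuit that continues a partial circuit, whose last element has offset `p` in row `i`,
`s` elements of the sign of the last one and `u` of the opposite sign, has at most `k` elements
of one of the signs after `m` further rows. -/
def HasBadCircuit (k w : ℕ) (d : ℕ → ℕ → Bool) : ℕ → ℕ → ℕ → ℕ → ℕ → Prop
  | 0, _, _, s, u => s ≤ k ∨ u ≤ k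
  | m + 1, i, p, s, u => ∃ q, p ≤ q ∧ q ≤ w ∧
      if signChange (d i) p q then HasBadCircuit k w d m (i + 1) q (s + 1) u
      else HasBadCircuit k w d m (i + 1) q (u + 1) s

/-- The property `HasBadCircuit` along a fixed sequence `q` of offsets. -/
def IsBadAlong (k : ℕ) (d : ℕ → ℕ → Bool) (q : ℕ → ℕ) : ℕ → ℕ → ℕ → ℕ → Prop
  | 0, _, s, u => s ≤ k ∨ u ≤ k
  | m + 1, i, s, u => if signChange (d i) (q i) (q (i + 1)) then IsBadAlong k d q m (i + 1) (s + 1) u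
      else IsBadAlong k d q m (i + 1) (u + 1) s

theorem isBadAlong_congr {k : ℕ} {d : ℕ → ℕ → Bool} {q q' : ℕ → ℕ} {m i : ℕ} (s u : ℕ)
    (h : ∀ l, i ≤ l → q l = q' l) : IsBadAlong k d q m i s u ↔ IsBadAlong k d q' m i s u := by
  induction m generalizing i s u with
  | zero => rfl
  | succ m ih =>
    simp only [IsBadAlong, h i le_rfl, h (i + 1) (by omega)]
    split_ifs <;> exact ih _ _ fun l hl => h l (by omega)

/-- The successive choices of offsets are collected into one weakly increasing sequence, so that a
bad path can be matched with the support of a circuit. -/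
theorem hasBadCircuit_iff {k w : ℕ} {d : ℕ → ℕ → Bool} {m i p s u : ℕ} :
    HasBadCircuit k w d m i p s u ↔ ∃ q : ℕ → ℕ, q i = p ∧
      (∀ l, i ≤ l → l < i + m → q l ≤ q (l + 1) ∧ q (l + 1) ≤ w) ∧ IsBadAlong k d q m i s u := by
  induction m generalizing i p s u with
  | zero =>
    refine ⟨fun h => ⟨fun _ => p, rfl, fun l h1 h2 => by omega, h⟩, fun ⟨q, _, _, h⟩ => h⟩
  | succ m ih =>
    simp only [HasBadCircuit, ih, IsBadAlong]
    constructor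
    · rintro ⟨q1, h1, h2, h⟩
      have key : ∀ s' u', (∃ q : ℕ → ℕ, q (i + 1) = q1 ∧ (∀ l, i + 1 ≤ l → l < i + 1 + m →
          q l ≤ q (l + 1) ∧ q (l + 1) ≤ w) ∧ IsBadAlong k d q m (i + 1) s' u') →
          ∃ q : ℕ → ℕ, q i = p ∧ q (i + 1) = q1 ∧ (∀ l, i ≤ l → l < i + (m + 1) →
          q l ≤ q (l + 1) ∧ q (l + 1) ≤ w) ∧ IsBadAlong k d q m (i + 1) s' u' := by
        rintro s' u' ⟨q, hq, hmono, hb⟩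
        refine ⟨Function.update q i p, by simp, by simp [hq], fun l hl hl' => ?_, ?_⟩
        · rcases hl.eq_or_lt with rfl | hl
          · simpa [hq] using ⟨h1, h2⟩
          · rw [Function.update_of_ne (by omega), Function.update_of_ne (by omega)]
            exact hmono l hl (by omega)
        · refine (isBadAlong_congr s' u' fun l hl => ?_).2 hb
          rw [Function.update_of_ne (by omega)]
      split_ifs at h with hc
      · obtain ⟨q, e1, e2, e3, e4⟩ := key _ _ h
        exact ⟨q, e1, e3, by rw [e1, e2, if_pos hc]; exact e4⟩
      · obtain ⟨q, e1, e2, e3, e4⟩ := key _ _ h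
        exact ⟨q, e1, e3, by rw [e1, e2, if_neg hc]; exact e4⟩
    · rintro ⟨q, rfl, hmono, h⟩
      refine ⟨q (i + 1), (hmono i le_rfl (by omega)).1, (hmono i le_rfl (by omega)).2, ?_⟩
      split_ifs at h ⊢ with hc
      · exact ⟨q, rfl, fun l h1 h2 => hmono l (by omega) (by omega), h⟩
      · exact ⟨q, rfl, fun l h1 h2 => hmono l (by omega) (by omega), h⟩

/-- Among the first `l + 1` terms, the number of those equal to `a`. -/
def countEq (x : ℕ → SignType) (a : SignType) (l : ℕ) : ℕ :=
  ((range (l + 1)).filter fun i => x i = a).card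

theorem countEq_succ (x : ℕ → SignType) (a : SignType) (l : ℕ) :
    countEq x a (l + 1) = countEq x a l + if x (l + 1) = a then 1 else 0 := by
  unfold countEq
  rw [range_add_one (n := l + 1), filter_insert]
  split_ifs
  · rw [card_insert_of_notMem (by simp)]
  · simp

/-- The invariant is that `s` and `u` count the signs so far that are equal, respectively opposite,
to the last one. At the end these are the two sign counts in some order, which is immaterial as the
condition is symmetric. -/
theorem isBadAlong_iff_countEq {k : ℕ} {d : ℕ → ℕ → Bool} {q : ℕ → ℕ} {x : ℕ → SignType}
    (hx : ∀ l, x l ≠ 0) (m i : ℕ)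
    (hstep : ∀ l, i ≤ l → l < i + m →
      x (l + 1) = if signChange (d l) (q l) (q (l + 1)) then x l else -x l) :
    IsBadAlong k d q m i (countEq x (x i) i) (countEq x (-x i) i) ↔
      countEq x 1 (i + m) ≤ k ∨ countEq x (-1) (i + m) ≤ k := by
  induction m generalizing i with
  | zero =>
    have : ∀ a : SignType, a ≠ 0 → a = 1 ∨ a = -1 := by decide
    rcases this _ (hx i) with h | h
    · simp [IsBadAlong, h]
    · simp [IsBadAlong, h, or_comm]
  | succ m ih =>
    have h1 := hstep i le_rfl (by omega)
    have h2 := ih (i + 1) fun l hl hl' => hstep l (by omega) (by omega)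
    have hne : ∀ a : SignType, a ≠ 0 → a ≠ -a ∧ -a ≠ a := by decide
    have hne' := hne _ (hx i)
    rw [show i + (m + 1) = i + 1 + m by omega, ← h2, IsBadAlong, countEq_succ, countEq_succ]
    split_ifs at h1 ⊢ with hc hc' <;> simp_all

theorem card_filter_eq_countEq {n : ℕ} {X : Fin n → SignType} {j : Fin (r + 1) → Fin n}
    (hj : StrictMono j) (hXj : ∀ e, X e ≠ 0 ↔ e ∈ Set.range j) {a : SignType} (ha : a ≠ 0) :
    (univ.filter fun e => X e = a).card = countEq (fun l => X (j (Fin.ofNat (r + 1) l))) a r := by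
  have h1 : (univ.filter fun e => X e = a) = (univ.filter fun i => X (j i) = a).map
      ⟨j, hj.injective⟩ := by
    ext e
    simp only [mem_filter, mem_univ, true_and, mem_map, Function.Embedding.coeFn_mk]
    constructor
    · intro h
      obtain ⟨i, rfl⟩ := (hXj e).1 (by rwa [h])
      exact ⟨i, h, rfl⟩
    · rintro ⟨i, h, rfl⟩; exact h
  rw [h1, card_map, countEq]
  refine card_bij (fun i _ => (i : ℕ)) ?_ ?_ ?_
  · intro i hi
    exact mem_filter.2 ⟨mem_range.2 i.2, by simpa using hi⟩
  · intro i _ i' _ h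
    exact Fin.ext h
  · intro l hl
    rw [mem_filter, mem_range] at hl
    exact ⟨Fin.ofNat (r + 1) l, by simpa using hl.2, by simp [Nat.mod_eq_of_lt hl.1]⟩

theorem step_signMatrix {d : ℕ → ℕ → Bool} {X : Fin (r + w + 1) → SignType}
    (hX : X ∈ lawrenceCircuits (signMatrix r (r + w + 1) d))
    {j : Fin (r + 1) → Fin (r + w + 1)} (hj : StrictMono j)
    (hXj : ∀ e, X e ≠ 0 ↔ e ∈ Set.range j) {q : ℕ → ℕ}
    (hq : ∀ i : Fin (r + 1), (j i : ℕ) = i + q i) (l : ℕ) (hl : l < r) :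
    X (j (Fin.ofNat (r + 1) (l + 1))) = if signChange (d l) (q l) (q (l + 1)) then
      X (j (Fin.ofNat (r + 1) l)) else -X (j (Fin.ofNat (r + 1) l)) := by
  have h := step_of_mem_lawrenceCircuits hX hj hXj ⟨l, hl⟩
  have e1 : Fin.ofNat (r + 1) (l + 1) = Fin.succ ⟨l, hl⟩ := by
    ext; simp [hl]
  have e2 : Fin.ofNat (r + 1) l = Fin.castSucc ⟨l, hl⟩ := by
    ext; simp [Nat.mod_eq_of_lt (show l < r + 1 by omega)]
  rw [e1, e2, h]
  simp only [signMatrix, hq, Fin.val_castSucc, Fin.val_succ, Nat.add_sub_cancel_left,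
    show l + 1 + q (l + 1) - l = q (l + 1) + 1 by omega, signChange]
  have key : ∀ (a b : Bool) (c : SignType),
      -(boolSign a * boolSign b * c) = if (b ^^ a) = true then c else -c := by decide
  exact key _ _ _

/-- Supports correspond to weakly increasing offset sequences by `j i = i + q i`. The initial counts
`1`, `0` describe the first element alone. -/
theorem isNeighborly_iff {k : ℕ} {M : OrientedMatroid (Fin (r + w + 1))} {d : ℕ → ℕ → Bool}
    (hM : M.circuits = lawrenceCircuits (signMatrix r (r + w + 1) d)) :
    M.IsNeighborly k ↔ ¬ ∃ p ≤ w, HasBadCircuit k w d r 0 p 1 0 := by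
  have key : ∀ {X : Fin (r + w + 1) → SignType}, X ∈ M.circuits →
      ∀ {j : Fin (r + 1) → Fin (r + w + 1)}, StrictMono j →
      (∀ e, X e ≠ 0 ↔ e ∈ Set.range j) → ∀ {q : ℕ → ℕ}, (∀ i : Fin (r + 1), (j i : ℕ) = i + q i) →
      (IsBadAlong k d q r 0 1 0 ↔
        ¬ (k < (SignVec.pos X).card ∧ k < (SignVec.neg X).card)) := by
    intro X hX j hj hXj q hq
    set x : ℕ → SignType := fun l => X (j (Fin.ofNat (r + 1) l)) with hx
    have hx0 : ∀ l, x l ≠ 0 := fun l => (hXj _).2 ⟨_, rfl⟩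
    have h := isBadAlong_iff_countEq (k := k) hx0 r 0 fun l _ hl =>
      step_signMatrix (hM ▸ hX) hj hXj hq l (by omega)
    have h1 : countEq x (x 0) 0 = 1 := by simp [countEq, filter_singleton]
    have h2 : countEq x (-x 0) 0 = 0 := by
      have : ∀ a : SignType, a ≠ 0 → a ≠ -a := by decide
      simp [countEq, filter_singleton, this _ (hx0 0)]
    rw [h1, h2, zero_add, ← card_filter_eq_countEq hj hXj (by decide),
      ← card_filter_eq_countEq hj hXj (by decide)] at h
    rw [h, not_and_or, not_lt, not_lt]
    rfl
  constructor
  · rintro hN ⟨p, hp, hbad⟩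
    obtain ⟨q, hq0, hmono, hb⟩ := hasBadCircuit_iff.1 hbad
    have hqw : ∀ l ≤ r, q l ≤ w := by
      intro l hl
      cases l with
      | zero => omega
      | succ l => exact (hmono l (by omega) (by omega)).2
    set j : Fin (r + 1) → Fin (r + w + 1) := fun i => ⟨i + q i, by
      have := hqw i (by omega); omega⟩ with hj
    have hjm : StrictMono j := by
      rw [Fin.strictMono_iff_lt_succ]
      intro i
      have := (hmono i (by omega) (by omega)).1
      simp only [hj, Fin.lt_def, Fin.val_castSucc, Fin.val_succ]
      omega
    obtain ⟨X, hX, hXj⟩ := exists_mem_lawrenceCircuits (by omega)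
      (signMatrix_ne_zero (r := r) (n := r + w + 1) d) hjm
    exact (key (hM ▸ hX) hjm hXj fun _ => rfl).1 hb (hN X (hM ▸ hX))
  · intro h X hX
    by_contra hX'
    obtain ⟨j, hj, hXj, -⟩ : X ∈ lawrenceCircuits _ := hM ▸ hX
    have hbd := le_of_strictMono_fin hj
    -- The subtraction is exact for `l ≤ r`, where `l ≤ j l`; the values beyond `r` are never read.
    set q : ℕ → ℕ := fun l => j (Fin.ofNat (r + 1) l) - l with hq
    have hqj : ∀ i : Fin (r + 1), (j i : ℕ) = i + q i := by
      intro i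
      have := hbd i
      simp only [hq, Fin.ofNat_eq_cast, Fin.cast_val_eq_self]
      omega
    have hb := (key hX hj hXj hqj).2 hX'
    refine h ⟨q 0, ?_, hasBadCircuit_iff.2 ⟨q, rfl, fun l _ hl => ?_, hb⟩⟩
    · have h1 := hqj 0
      have h2 := hbd 0
      simp only [Fin.val_zero] at h1 h2
      omega
    · have h1 := hqj (Fin.castSucc ⟨l, by omega⟩)
      have h2 := hqj (Fin.succ ⟨l, by omega⟩)
      have h3 := hj (Fin.castSucc_lt_succ (i := (⟨l, by omega⟩ : Fin r)))
      have h4 := hbd (Fin.succ ⟨l, by omega⟩)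
      simp only [Fin.lt_def, Fin.val_castSucc, Fin.val_succ] at h1 h2 h3 h4
      omega

end SignDifferences

/-! ### Counting by truth tables

The functions of this section are evaluated on Booleans and, bitwise, on truth tables that are
encoded by natural numbers. The operations are passed as arguments; `mux e a b` is `a` if `e`
and `b` otherwise, `z` is false and `o` is true. -/

section TruthTables

variable {α β : Type}

/-- Four values, one for each offset. -/
@[ext]
structure Quad (α : Type) where
  a : α
  b : α
  c : α
  d : α

/-- From the values at the numbers `1, …, l + 1` of equal signs, the values at `1, …, l` before a
step that keeps the sign if `e` and reverses it otherwise. -/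
def signStep (mux : α → α → α → α) (e : α) (L : List α) : List α :=
  List.zipWith (mux e) L.tail L.reverse.tail

/-- One row of the backward recursion for `HasBadCircuit`, with sign differences `d₀, …, d₃`. -/
def rowStep (xor or : α → α → α) (mux : α → α → α → α) (d₀ d₁ d₂ d₃ : α)
    (L : Quad (List α)) : Quad (List α) :=
  ⟨List.zipWith or (signStep mux d₀ L.a)
      (List.zipWith or (signStep mux (xor d₀ d₁) L.b)
        (List.zipWith or (signStep mux (xor d₀ (xor d₁ d₂)) L.c)
          (signStep mux (xor d₀ (xor d₁ (xor d₂ d₃))) L.d))),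
    List.zipWith or (signStep mux d₁ L.b)
        (List.zipWith or (signStep mux (xor d₁ d₂) L.c)
          (signStep mux (xor d₁ (xor d₂ d₃)) L.d)),
    List.zipWith or (signStep mux d₂ L.c) (signStep mux (xor d₂ d₃) L.d),
    signStep mux d₃ L.d⟩

/-- Addition of binary numbers, least significant bit first. -/
def rippleAdd (xor : α → α → α) (mux : α → α → α → α) : α → List α → List α → List α
  | c, a :: l, b :: m => xor (xor a b) c :: rippleAdd xor mux (mux (xor a b) c a) l m
  | c, _, _ => [c]

/-- The binary number of choices of the differences of the reorientation at the given rows for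
which there is no bad circuit. The rows are listed from the last to the first, and `g₁, g₂, g₃`
are the differences of the reorientation that the first one of the list shares with its
predecessors in this order. -/
def countGood (xor or : α → α → α) (mux : α → α → α → α) (z o : α) :
    List (α × α × α) → α → α → α → Quad (List α) → List α
  | [], _, _, _, L => List.zipWith (fun x y => xor o (or x y))
      (List.zipWith or L.a L.b) (List.zipWith or L.c L.d)
  | (v₀, v₁, v₂) :: rows, g₁, g₂, g₃, L =>
    rippleAdd xor mux z
      (countGood xor or mux z o rows z g₁ g₂
        (rowStep xor or mux (xor v₀ z) (xor v₁ g₁) (xor v₂ g₂) g₃ L))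
      (countGood xor or mux z o rows o g₁ g₂
        (rowStep xor or mux (xor v₀ o) (xor v₁ g₁) (xor v₂ g₂) g₃ L))

/-- The values at the end of a circuit with eight elements. -/
def finalQuad (z o : α) : Quad (List α) :=
  ⟨[o, o, z, z, z, o, o, o], [o, o, z, z, z, o, o, o], [o, o, z, z, z, o, o, o],
    [o, o, z, z, z, o, o, o]⟩

/-- The binary number of all choices without bad circuit. -/
def countAll (xor or : α → α → α) (mux : α → α → α → α) (z o : α)
    (rows : List (α × α × α)) : List α :=
  let f := fun g₁ g₂ g₃ => countGood xor or mux z o rows g₁ g₂ g₃ (finalQuad z o)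
  let add := rippleAdd xor mux z
  add (add (add (f z z z) (f o z z)) (add (f z o z) (f o o z)))
    (add (add (f z z o) (f o z o)) (add (f z o o) (f o o o)))

/-- The free differences of a code, the last row first. -/
def codeRows (z : α) (v : ℕ → α) : List (α × α × α) :=
  [(v 15, v 16, v 17), (v 12, v 13, v 14), (v 9, v 10, v 11), (v 6, v 7, v 8), (v 3, v 4, v 5),
    (v 0, v 1, v 2), (z, z, z)]

/-- Whether the code is not one of the extremal ones. -/
def notExtremal (xor or : α → α → α) (v : ℕ → α) : α :=
  or (or (or (v 3) (or (v 4) (v 7))) (or (v 10) (or (v 13) (v 16))))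
    (or (or (xor (v 2) (v 6)) (xor (v 5) (v 9))) (or (xor (v 8) (v 12)) (xor (v 11) (v 15))))

/-- Whether the number with the given bits exceeds `56`, or whether it is equal to `56` for a code
that is not extremal, or different from `56` for an extremal one. -/
def violates (xor or : α → α → α) (mux : α → α → α → α) (z o ne : α) : List α → α
  | [c₀, c₁, c₂, c₃, c₄, c₅, c₆, c₇, c₈, c₉, c₁₀] =>
    or (or (or (or c₆ c₇) (or c₈ (or c₉ c₁₀)))
        (mux (mux c₅ (mux c₄ c₃ z) z) (or c₀ (or c₁ c₂)) z))
      (xor (mux c₅ (mux c₄ c₃ z) z) (xor o ne))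
  | _ => o

/-- The check of the number of choices for the code `v`. -/
def codeViolates (xor or : α → α → α) (mux : α → α → α → α) (z o : α) (v : ℕ → α) : α :=
  violates xor or mux z o (notExtremal xor or v) (countAll xor or mux z o (codeRows z v))

/-- Only 18 variables are read, so it does not matter how a code is extended beyond them. -/
theorem codeViolates_congr {xor or : α → α → α} {mux : α → α → α → α} {z o : α} {v v' : ℕ → α}
    (h : ∀ k < 18, v k = v' k) :
    codeViolates xor or mux z o v = codeViolates xor or mux z o v' := by
  have hr : codeRows z v = codeRows z v' := by
    simp only [codeRows, h _ (show 0 < 18 by decide), h _ (show 1 < 18 by decide),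
      h _ (show 2 < 18 by decide), h _ (show 3 < 18 by decide), h _ (show 4 < 18 by decide),
      h _ (show 5 < 18 by decide), h _ (show 6 < 18 by decide), h _ (show 7 < 18 by decide),
      h _ (show 8 < 18 by decide), h _ (show 9 < 18 by decide), h _ (show 10 < 18 by decide),
      h _ (show 11 < 18 by decide), h _ (show 12 < 18 by decide), h _ (show 13 < 18 by decide),
      h _ (show 14 < 18 by decide), h _ (show 15 < 18 by decide), h _ (show 16 < 18 by decide),
      h _ (show 17 < 18 by decide)]
  have hn : notExtremal xor or v = notExtremal xor or v' := by
    simp only [codeRows, List.cons.injEq, Prod.mk.injEq] at hr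
    simp only [notExtremal, hr]
  rw [codeViolates, hr, hn, codeViolates]

/-! ### Compatibility of the computation with maps that preserve the operations -/

section Hom

variable {xor or : α → α → α} {mux : α → α → α → α} {z o : α} {xor' or' : β → β → β}
  {mux' : β → β → β → β} {z' o' : β} {φ : α → β}

theorem map_signStep (hm : ∀ e a b, φ (mux e a b) = mux' (φ e) (φ a) (φ b)) (e : α) (L : List α) :
    (signStep mux e L).map φ = signStep mux' (φ e) (L.map φ) := by
  simp only [signStep, List.map_zipWith, hm, ← List.map_reverse, ← List.map_tail,
    List.zipWith_map]

/-- Apply a function to all entries. -/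
def Quad.map (φ : α → β) (L : Quad (List α)) : Quad (List β) :=
  ⟨L.a.map φ, L.b.map φ, L.c.map φ, L.d.map φ⟩

theorem map_zipWith_of_hom {op : α → α → α} {op' : β → β → β}
    (h : ∀ a b, φ (op a b) = op' (φ a) (φ b)) (L M : List α) :
    (List.zipWith op L M).map φ = List.zipWith op' (L.map φ) (M.map φ) := by
  simp only [List.map_zipWith, h, List.zipWith_map]

theorem map_rowStep (hx : ∀ a b, φ (xor a b) = xor' (φ a) (φ b))
    (ho : ∀ a b, φ (or a b) = or' (φ a) (φ b))
    (hm : ∀ e a b, φ (mux e a b) = mux' (φ e) (φ a) (φ b)) (d₀ d₁ d₂ d₃ : α)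
    (L : Quad (List α)) : (rowStep xor or mux d₀ d₁ d₂ d₃ L).map φ =
      rowStep xor' or' mux' (φ d₀) (φ d₁) (φ d₂) (φ d₃) (L.map φ) := by
  simp only [rowStep, Quad.map, map_zipWith_of_hom ho, map_signStep hm, hx]

theorem map_rippleAdd (hx : ∀ a b, φ (xor a b) = xor' (φ a) (φ b))
    (hm : ∀ e a b, φ (mux e a b) = mux' (φ e) (φ a) (φ b)) (c : α) (L M : List α) :
    (rippleAdd xor mux c L M).map φ = rippleAdd xor' mux' (φ c) (L.map φ) (M.map φ) := by
  induction L generalizing c M with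
  | nil => simp [rippleAdd]
  | cons a L ih =>
    cases M with
    | nil => simp [rippleAdd]
    | cons b M => simp [rippleAdd, ih, hx, hm]

theorem map_countGood (hx : ∀ a b, φ (xor a b) = xor' (φ a) (φ b))
    (ho : ∀ a b, φ (or a b) = or' (φ a) (φ b))
    (hm : ∀ e a b, φ (mux e a b) = mux' (φ e) (φ a) (φ b)) (hz : φ z = z') (ho' : φ o = o')
    (rows : List (α × α × α)) (g₁ g₂ g₃ : α) (L : Quad (List α)) :
    (countGood xor or mux z o rows g₁ g₂ g₃ L).map φ =
      countGood xor' or' mux' z' o' (rows.map fun v => (φ v.1, φ v.2.1, φ v.2.2))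
        (φ g₁) (φ g₂) (φ g₃) (L.map φ) := by
  induction rows generalizing g₁ g₂ g₃ L with
  | nil =>
    simp only [countGood, List.map_nil]
    rw [map_zipWith_of_hom (op' := fun x y => xor' o' (or' x y)) (by simp [hx, ho, ho']),
      map_zipWith_of_hom ho, map_zipWith_of_hom ho]
    rfl
  | cons v rows ih =>
    simp only [countGood, List.map_cons, map_rippleAdd hx hm, ih, map_rowStep hx ho hm, hx, hz,
      ho']

theorem map_countAll (hx : ∀ a b, φ (xor a b) = xor' (φ a) (φ b))
    (ho : ∀ a b, φ (or a b) = or' (φ a) (φ b))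
    (hm : ∀ e a b, φ (mux e a b) = mux' (φ e) (φ a) (φ b)) (hz : φ z = z') (ho' : φ o = o')
    (rows : List (α × α × α)) :
    (countAll xor or mux z o rows).map φ =
      countAll xor' or' mux' z' o' (rows.map fun v => (φ v.1, φ v.2.1, φ v.2.2)) := by
  have hq : (finalQuad z o).map φ = finalQuad z' o' := by simp [finalQuad, Quad.map, hz, ho']
  simp only [countAll, map_rippleAdd hx hm, map_countGood hx ho hm hz ho', hz, ho', hq]

/-- The only point beyond preservation of the operations is the fallback value for lists that do not
have 11 entries: it depends on the length alone, which mapping preserves. -/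
theorem map_violates (hx : ∀ a b, φ (xor a b) = xor' (φ a) (φ b))
    (ho : ∀ a b, φ (or a b) = or' (φ a) (φ b))
    (hm : ∀ e a b, φ (mux e a b) = mux' (φ e) (φ a) (φ b)) (hz : φ z = z') (ho' : φ o = o')
    (ne : α) (L : List α) :
    φ (violates xor or mux z o ne L) = violates xor' or' mux' z' o' (φ ne) (L.map φ) := by
  by_cases hL : L.length = 11
  · obtain ⟨c₀, c₁, c₂, c₃, c₄, c₅, c₆, c₇, c₈, c₉, c₁₀, rfl⟩ :
        ∃ c₀ c₁ c₂ c₃ c₄ c₅ c₆ c₇ c₈ c₉ c₁₀, L = [c₀, c₁, c₂, c₃, c₄, c₅, c₆, c₇, c₈, c₉, c₁₀] := by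
      rcases L with _ | ⟨c₀, _ | ⟨c₁, _ | ⟨c₂, _ | ⟨c₃, _ | ⟨c₄, _ | ⟨c₅, _ | ⟨c₆, _ | ⟨c₇, _ | ⟨c₈,
        _ | ⟨c₉, _ | ⟨c₁₀, _ | ⟨c, L⟩⟩⟩⟩⟩⟩⟩⟩⟩⟩⟩⟩ <;> simp_all
    simp only [violates, List.map_cons, List.map_nil, hx, ho, hm, hz, ho']
  · have h1 : violates xor or mux z o ne L = o := by
      unfold violates
      split
      · simp at hL
      · rfl
    have h2 : violates xor' or' mux' z' o' (φ ne) (L.map φ) = o' := by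
      unfold violates
      split
      · rename_i heq
        have := congrArg List.length heq
        simp at this
        omega
      · rfl
    rw [h1, h2, ho']

theorem map_codeViolates (hx : ∀ a b, φ (xor a b) = xor' (φ a) (φ b))
    (ho : ∀ a b, φ (or a b) = or' (φ a) (φ b))
    (hm : ∀ e a b, φ (mux e a b) = mux' (φ e) (φ a) (φ b)) (hz : φ z = z') (ho' : φ o = o')
    (v : ℕ → α) :
    φ (codeViolates xor or mux z o v) = codeViolates xor' or' mux' z' o' (fun k => φ (v k)) := by
  simp only [codeViolates, map_violates hx ho hm hz ho', map_countAll hx ho hm hz ho',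
    notExtremal, hx, ho, codeRows, List.map_cons, List.map_nil, hz]

end Hom

/-! ### Truth tables as natural numbers and the evaluation for all codes -/

/-- The bitwise choice between two natural numbers. -/
def natMux (e a b : ℕ) : ℕ := Nat.xor b (Nat.land e (Nat.xor a b))

/-- `2 ^ k` copies of the block `T` of `w` bits. -/
def repeatBlock : ℕ → ℕ → ℕ → ℕ
  | 0, _, T => T
  | k + 1, w, T => repeatBlock k (2 * w) (Nat.lor T (Nat.shiftLeft T w))

/-- The truth table of the `v`-th of `n` variables. -/
def varTable (n v : ℕ) : ℕ :=
  repeatBlock (n - (v + 1)) (2 ^ (v + 1)) (Nat.shiftLeft (2 ^ 2 ^ v - 1) (2 ^ v))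

theorem testBit_natMux (e a b x : ℕ) :
    (natMux e a b).testBit x = cond (e.testBit x) (a.testBit x) (b.testBit x) := by
  have : natMux e a b = b ^^^ (e &&& (a ^^^ b)) := rfl
  rw [this, Nat.testBit_xor, Nat.testBit_and, Nat.testBit_xor]
  cases e.testBit x <;> cases a.testBit x <;> cases b.testBit x <;> rfl

/-- Doubling the block doubles the period, and reducing modulo `2 * w` before reducing modulo `w`
changes nothing. -/
theorem testBit_repeatBlock (k w T : ℕ) (hT : T < 2 ^ w) {x : ℕ} (hx : x < w * 2 ^ k) :
    (repeatBlock k w T).testBit x = T.testBit (x % w) := by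
  induction k generalizing w T with
  | zero => rw [repeatBlock, Nat.mod_eq_of_lt (by simpa using hx)]
  | succ k ih =>
    have hw : 0 < w := Nat.pos_of_ne_zero fun h => by simp [h] at hx
    have e1 : Nat.lor T (Nat.shiftLeft T w) = T ||| (T <<< w) := rfl
    have hlt : T ||| (T <<< w) < 2 ^ (2 * w) := by
      refine Nat.or_lt_two_pow (hT.trans_le (Nat.pow_le_pow_right (by omega) (by omega))) ?_
      rw [Nat.shiftLeft_eq, two_mul, pow_add]
      exact Nat.mul_lt_mul_of_pos_right hT (by positivity)
    rw [repeatBlock, e1, ih _ _ hlt (by rw [pow_succ] at hx; linarith), Nat.testBit_or,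
      Nat.testBit_shiftLeft, ← Nat.mod_mul_left_mod x 2 w]
    have h2 := Nat.mod_lt x (show 0 < 2 * w by omega)
    set y := x % (2 * w)
    rcases lt_or_ge y w with h | h
    · rw [Nat.mod_eq_of_lt h]; simp [h]
    · have h3 : y % w = y - w := by
        rw [Nat.mod_eq_sub_mod h, Nat.mod_eq_of_lt (by omega)]
      rw [h3, Nat.testBit_lt_two_pow (hT.trans_le (Nat.pow_le_pow_right (by omega) h))]
      simp [h]

theorem testBit_varTable {n v x : ℕ} (hv : v < n) (hx : x < 2 ^ n) :
    (varTable n v).testBit x = x.testBit v := by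
  have e1 : Nat.shiftLeft (2 ^ 2 ^ v - 1) (2 ^ v) = (2 ^ 2 ^ v - 1) <<< (2 ^ v) := rfl
  rw [varTable, e1, testBit_repeatBlock, Nat.testBit_shiftLeft, Nat.testBit_two_pow_sub_one,
    Nat.testBit_eq_decide_div_mod_eq, Nat.mod_pow_succ]
  · have h1 := Nat.mod_lt x (Nat.two_pow_pos v)
    rcases Nat.mod_two_eq_zero_or_one (x / 2 ^ v) with h | h
    · rw [h]; simp [h1]
    · rw [h]; simp [h1]
  · rw [Nat.shiftLeft_eq, pow_succ 2 v, mul_two, pow_add]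
    exact Nat.mul_lt_mul_of_pos_right (Nat.sub_lt (by positivity) one_pos) (by positivity)
  · rw [← pow_add, Nat.add_sub_cancel' hv]; exact hx

/-- Bit `x` of each table is the value for the code with binary digits `x`, so the vanishing of this
single number verifies all `2 ^ 18` codes. -/
theorem codeViolates_tables :
    codeViolates Nat.xor Nat.lor natMux 0 (2 ^ 2 ^ 18 - 1) (varTable 18) = 0 := by
  decide +kernel

/-- Reading bit `x` respects all the operations, and sends the table of variable `k` to bit `k` of
`x`. Applied to the number `x` whose digits are `b`, it extracts the statement for `b` from the
tables. -/
theorem codeViolates_bool (b : Fin 18 → Bool) :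
    codeViolates Bool.xor Bool.or cond false true (fun k => if h : k < 18 then b ⟨k, h⟩ else false) =
      false := by
  have hx := Nat.ofBits_lt_two_pow b
  set x := Nat.ofBits b with hxb
  have h := map_codeViolates (φ := fun T : ℕ => T.testBit x) (xor := Nat.xor) (or := Nat.lor)
    (mux := natMux) (z := 0) (o := 2 ^ 2 ^ 18 - 1) (fun a b => Nat.testBit_xor a b x)
    (fun a b => Nat.testBit_or a b x) (fun e a b => testBit_natMux e a b x) (Nat.zero_testBit x)
    (by rw [Nat.testBit_two_pow_sub_one, decide_eq_true hx]) (varTable 18)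
  rw [codeViolates_tables, Nat.zero_testBit] at h
  refine (codeViolates_congr fun k hk => ?_).trans h.symm
  rw [testBit_varTable hk hx, dif_pos hk, hxb, Nat.testBit_ofBits_lt]

end TruthTables

/-! ### The computed number is the number of good reorientation differences -/

section CountSemantics

open Finset

/-- The sum of `F` over all functions that agree with `G` from `n` on. -/
def sumBits : ℕ → (ℕ → Bool) → ((ℕ → Bool) → ℕ) → ℕ
  | 0, G, F => F G
  | n + 1, G, F => sumBits n (Function.update G n false) F + sumBits n (Function.update G n true) F

theorem sumBits_eq_sum (n : ℕ) (G : ℕ → Bool) (F : (ℕ → Bool) → ℕ) :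
    sumBits n G F = ∑ g : Fin n → Bool, F (fun k => if h : k < n then g ⟨k, h⟩ else G k) := by
  induction n generalizing G with
  | zero => simp [sumBits]
  | succ n ih =>
    rw [sumBits, ih, ih, ← (Fin.snocEquiv fun _ : Fin (n + 1) => Bool).sum_comp,
      Fintype.sum_prod_type, Fintype.sum_bool, add_comm]
    have key : ∀ (x : Bool) (g : Fin n → Bool),
        (fun k => if h : k < n then g ⟨k, h⟩ else Function.update G n x k) =
        fun k => if h : k < n + 1 then (Fin.snocEquiv fun _ : Fin (n + 1) => Bool) (x, g) ⟨k, h⟩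
          else G k := by
      intro x g
      funext k
      rcases lt_trichotomy k n with h | rfl | h
      · have : (⟨k, by omega⟩ : Fin (n + 1)) = Fin.castSucc ⟨k, h⟩ := rfl
        rw [dif_pos h, dif_pos (by omega), this]
        simp [Fin.snocEquiv, Fin.snoc, h]
      · have : (⟨k, by omega⟩ : Fin (k + 1)) = Fin.last k := rfl
        rw [dif_neg (lt_irrefl k), dif_pos (by omega), this]
        simp [Fin.snocEquiv]
      · rw [dif_neg (by omega), dif_neg (by omega), Function.update_of_ne (by omega)]
    simp only [key]

/-- The value of a binary number, least significant bit first. -/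
def bitValue : List Bool → ℕ
  | [] => 0
  | b :: l => b.toNat + 2 * bitValue l

theorem bitValue_rippleAdd (c : Bool) (l m : List Bool) (h : l.length = m.length) :
    bitValue (rippleAdd Bool.xor cond c l m) = c.toNat + bitValue l + bitValue m := by
  induction l generalizing c m with
  | nil =>
    obtain rfl := List.length_eq_zero_iff.1 h.symm
    simp [rippleAdd, bitValue]
  | cons a l ih =>
    cases m with
    | nil => simp at h
    | cons b m =>
      rw [rippleAdd, bitValue, ih _ _ (by simpa using h), bitValue, bitValue]
      cases a <;> cases b <;> cases c <;> simp <;> omega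

theorem length_rippleAdd {α : Type} {xor : α → α → α} {mux : α → α → α → α} (c : α) (l m : List α)
    (h : l.length = m.length) : (rippleAdd xor mux c l m).length = l.length + 1 := by
  induction l generalizing c m with
  | nil => simp [rippleAdd]
  | cons a l ih =>
    cases m with
    | nil => simp at h
    | cons b m => simp [rippleAdd, ih _ m (by simpa using h)]

theorem hasBadCircuit_congr {k w : ℕ} {d d' : ℕ → ℕ → Bool} {m i : ℕ} (p s u : ℕ)
    (h : ∀ l, i ≤ l → d l = d' l) : HasBadCircuit k w d m i p s u ↔ HasBadCircuit k w d' m i p s u := by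
  induction m generalizing i p s u with
  | zero => rfl
  | succ m ih =>
    simp only [HasBadCircuit, h i le_rfl]
    refine exists_congr fun q => and_congr_right fun _ => and_congr_right fun _ => ?_
    split_ifs <;> exact ih _ _ _ fun l hl => h l (by omega)

open Classical in
/-- The truth values of `HasBadCircuit` for the numbers `1, …, i + 1` of equal signs. -/
noncomputable def levelList (d : ℕ → ℕ → Bool) (m i p : ℕ) : List Bool :=
  (List.range (i + 1)).map fun s => decide (HasBadCircuit 2 3 d m i p (s + 1) (i - s))

/-- The lists `levelList` for all offsets. -/
noncomputable def levelQuad (d : ℕ → ℕ → Bool) (m i : ℕ) : Quad (List Bool) :=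
  ⟨levelList d m i 0, levelList d m i 1, levelList d m i 2, levelList d m i 3⟩

/-- Index `s` stands for `s + 1` equal and `i - s` opposite signs. Keeping the sign leads to index
`s + 1`; reversing it exchanges the counts and leads to `i - s + 1` equal signs, index `i - s`.
Hence the reversed list. -/
theorem signStep_map_range (e : Bool) (f : ℕ → Bool) (i : ℕ) :
    signStep cond e ((List.range (i + 1 + 1)).map f) =
      (List.range (i + 1)).map fun s => cond e (f (s + 1)) (f (i - s)) := by
  apply List.ext_getElem
  · simp [signStep]
  · intro s h1 h2
    have hs : s < i + 1 := by simpa using h2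
    simp only [signStep, List.getElem_zipWith, List.getElem_tail, List.getElem_reverse,
      List.getElem_map, List.getElem_range, List.length_map, List.length_range]
    rw [show i + 1 + 1 - 1 - (s + 1) = i - s by omega]

theorem zipWith_map_range (f g : ℕ → Bool) (i : ℕ) :
    List.zipWith Bool.or ((List.range i).map f) ((List.range i).map g) =
      (List.range i).map fun s => f s || g s := by
  apply List.ext_getElem <;> simp

/-- A step from offset `p` to `q ≥ p` in row `i` passes the columns `i + p, …, i + q + 1`, so
whether it keeps the sign is the parity of `d i p, …, d i q`. The disjunction runs over the at most
four possible `q`. -/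
theorem rowStep_levelQuad (d : ℕ → ℕ → Bool) (m i : ℕ) :
    rowStep Bool.xor Bool.or cond (d i 0) (d i 1) (d i 2) (d i 3) (levelQuad d m (i + 1)) =
      levelQuad d (m + 1) i := by
  classical
  have hcond : ∀ p q s, s ∈ List.range (i + 1) →
      (decide (if signChange (d i) p q then HasBadCircuit 2 3 d m (i + 1) q (s + 1 + 1) (i - s)
        else HasBadCircuit 2 3 d m (i + 1) q (i - s + 1) (s + 1))) =
      cond (signChange (d i) p q)
        (decide (HasBadCircuit 2 3 d m (i + 1) q (s + 1 + 1) (i + 1 - (s + 1))))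
        (decide (HasBadCircuit 2 3 d m (i + 1) q (i - s + 1) (i + 1 - (i - s)))) := by
    intro p q s hs
    have hs' : s < i + 1 := List.mem_range.1 hs
    rw [show i + 1 - (s + 1) = i - s by omega, show i + 1 - (i - s) = s + 1 by omega]
    cases signChange (d i) p q <;> simp
  have h4 : ∀ (p : ℕ) (P : ℕ → Prop), (∃ q, p ≤ q ∧ q ≤ 3 ∧ P q) ↔
      (p ≤ 0 ∧ P 0) ∨ (p ≤ 1 ∧ P 1) ∨ (p ≤ 2 ∧ P 2) ∨ (p ≤ 3 ∧ P 3) := by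
    intro p P
    constructor
    · rintro ⟨q, h1, h2, h3⟩
      interval_cases q <;> simp_all
    · rintro (⟨h, h'⟩ | ⟨h, h'⟩ | ⟨h, h'⟩ | ⟨h, h'⟩)
      exacts [⟨0, h, by omega, h'⟩, ⟨1, h, by omega, h'⟩, ⟨2, h, by omega, h'⟩,
        ⟨3, h, by omega, h'⟩]
  unfold levelQuad rowStep
  simp only [levelList, signStep_map_range, zipWith_map_range]
  have e00 : signChange (d i) 0 0 = d i 0 := by simp [signChange, xorAccum]
  have e01 : signChange (d i) 0 1 = (d i 0 ^^ d i 1) := by simp [signChange, xorAccum]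
  have e02 : signChange (d i) 0 2 = (d i 0 ^^ (d i 1 ^^ d i 2)) := by
    simp [signChange, xorAccum]
  have e03 : signChange (d i) 0 3 = (d i 0 ^^ (d i 1 ^^ (d i 2 ^^ d i 3))) := by
    simp [signChange, xorAccum]
  have e11 : signChange (d i) 1 1 = d i 1 := by
    simp only [signChange, xorAccum]; generalize d i 0 = a; generalize d i 1 = b; revert a b; decide
  have e12 : signChange (d i) 1 2 = (d i 1 ^^ d i 2) := by
    simp only [signChange, xorAccum]; generalize d i 0 = a; generalize d i 1 = b
    generalize d i 2 = c; revert a b c; decide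
  have e13 : signChange (d i) 1 3 = (d i 1 ^^ (d i 2 ^^ d i 3)) := by
    simp only [signChange, xorAccum]; generalize d i 0 = a; generalize d i 1 = b
    generalize d i 2 = c; generalize d i 3 = e; revert a b c e; decide
  have e22 : signChange (d i) 2 2 = d i 2 := by
    simp only [signChange, xorAccum]; generalize d i 0 = a; generalize d i 1 = b
    generalize d i 2 = c; revert a b c; decide
  have e23 : signChange (d i) 2 3 = (d i 2 ^^ d i 3) := by
    simp only [signChange, xorAccum]; generalize d i 0 = a; generalize d i 1 = b
    generalize d i 2 = c; generalize d i 3 = e; revert a b c e; decide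
  have e33 : signChange (d i) 3 3 = d i 3 := by
    simp only [signChange, xorAccum]; generalize d i 0 = a; generalize d i 1 = b
    generalize d i 2 = c; generalize d i 3 = e; revert a b c e; decide
  ext1 <;> refine List.map_congr_left fun s hs => ?_ <;>
    simp only [HasBadCircuit, h4, Bool.decide_or, Bool.decide_and, hcond _ _ _ hs] <;>
    simp [e00, e01, e02, e03, e11, e12, e13, e22, e23, e33]

/-- The sign differences of a matrix after a reorientation. -/
def shiftDiff (D : ℕ → ℕ → Bool) (G : ℕ → Bool) (i t : ℕ) : Bool := D i t ^^ G (i + t)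

/-- The matrix with the sign differences `D`, reoriented with differences `G`, has no circuit with
at most two elements of one of the signs. -/
def IsGood (D : ℕ → ℕ → Bool) (G : ℕ → Bool) : Prop :=
  ¬ ∃ p ≤ 3, HasBadCircuit 2 3 (shiftDiff D G) 7 0 p 1 0

/-- The first three differences of the rows before row `i`, the last one first. -/
def diffRows (D : ℕ → ℕ → Bool) : ℕ → List (Bool × Bool × Bool)
  | 0 => []
  | i + 1 => (D i 0, D i 1, D i 2) :: diffRows D i

theorem levelQuad_congr {d d' : ℕ → ℕ → Bool} {m i : ℕ} (h : ∀ l, i ≤ l → d l = d' l) :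
    levelQuad d m i = levelQuad d' m i := by
  unfold levelQuad levelList
  ext1 <;>
    exact List.map_congr_left fun s _ => decide_eq_decide.2 (hasBadCircuit_congr _ _ _ h)

theorem length_countGood (D : ℕ → ℕ → Bool) (i : ℕ) (g₁ g₂ g₃ : Bool) (L : Quad (List Bool))
    (hL : L.a.length = i + 1 ∧ L.b.length = i + 1 ∧ L.c.length = i + 1 ∧ L.d.length = i + 1) :
    (countGood Bool.xor Bool.or cond false true (diffRows D i) g₁ g₂ g₃ L).length = i + 1 := by
  induction i generalizing g₁ g₂ g₃ L with
  | zero => simp [diffRows, countGood, hL]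
  | succ i ih =>
    rw [diffRows, countGood, length_rippleAdd, ih]
    · simp [rowStep, signStep, hL]
    · rw [ih, ih] <;> simp [rowStep, signStep, hL]

-- Induction on the number `i` of rows still to come. The values for the rows from `i` on involve
-- only `G l` with `l ≥ i`, so the bits below `i` can be summed out one at a time; each row
-- introduces just one new bit.
open Classical in
theorem bitValue_countGood (D : ℕ → ℕ → Bool) (hD : ∀ i, D i 3 = false) (i : ℕ) (hi : i ≤ 7)
    (G : ℕ → Bool) :
    bitValue (countGood Bool.xor Bool.or cond false true (diffRows D i) (G i) (G (i + 1))
      (G (i + 2)) (levelQuad (shiftDiff D G) (7 - i) i)) =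
      sumBits i G fun G => if IsGood D G then 1 else 0 := by
  induction i generalizing G with
  | zero =>
    have h4 : (∃ p ≤ 3, HasBadCircuit 2 3 (shiftDiff D G) 7 0 p 1 0) ↔
        (HasBadCircuit 2 3 (shiftDiff D G) 7 0 0 1 0 ∨
          HasBadCircuit 2 3 (shiftDiff D G) 7 0 1 1 0) ∨
        (HasBadCircuit 2 3 (shiftDiff D G) 7 0 2 1 0 ∨
          HasBadCircuit 2 3 (shiftDiff D G) 7 0 3 1 0) := by
      constructor
      · rintro ⟨p, hp, h⟩
        interval_cases p <;> simp [h]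
      · rintro ((h | h) | (h | h))
        exacts [⟨0, by omega, h⟩, ⟨1, by omega, h⟩, ⟨2, by omega, h⟩, ⟨3, by omega, h⟩]
    rw [sumBits, IsGood, h4]
    simp only [diffRows, countGood, levelQuad, levelList, List.range_one, List.map_cons,
      List.map_nil, List.zipWith_cons_cons, List.zipWith_nil_left, bitValue, Nat.sub_zero,
      zero_add]
    by_cases h0 : HasBadCircuit 2 3 (shiftDiff D G) 7 0 0 1 0 <;>
    by_cases h1 : HasBadCircuit 2 3 (shiftDiff D G) 7 0 1 1 0 <;>
    by_cases h2 : HasBadCircuit 2 3 (shiftDiff D G) 7 0 2 1 0 <;>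
    by_cases h3 : HasBadCircuit 2 3 (shiftDiff D G) 7 0 3 1 0 <;>
    simp [h0, h1, h2, h3]
  | succ i ih =>
    -- Fixing `G i = x` affects row `i` at offset `0` and none of the later rows. The last argument
    -- has no matrix term because `D i 3` vanishes.
    have key : ∀ x : Bool, rowStep Bool.xor Bool.or cond (D i 0 ^^ x) (D i 1 ^^ G (i + 1))
        (D i 2 ^^ G (i + 1 + 1)) (G (i + 1 + 2)) (levelQuad (shiftDiff D G) (7 - (i + 1)) (i + 1)) =
        levelQuad (shiftDiff D (Function.update G i x)) (7 - i) i := by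
      intro x
      rw [show 7 - i = 7 - (i + 1) + 1 by omega, ← rowStep_levelQuad]
      congr 1
      · simp [shiftDiff]
      · simp [shiftDiff]
      · simp [shiftDiff, add_assoc]
      · simp [shiftDiff, hD, add_assoc]
      · refine levelQuad_congr fun l hl => ?_
        funext t
        simp [shiftDiff, Function.update_of_ne (show l + t ≠ i by omega)]
    have hval : ∀ x : Bool, bitValue (countGood Bool.xor Bool.or cond false true (diffRows D i) x
        (G (i + 1)) (G (i + 1 + 1))
        (levelQuad (shiftDiff D (Function.update G i x)) (7 - i) i)) =
        sumBits i (Function.update G i x) fun G => if IsGood D G then 1 else 0 := by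
      intro x
      have h := ih (by omega) (Function.update G i x)
      rwa [Function.update_self, Function.update_of_ne (by omega), Function.update_of_ne (by omega)]
        at h
    rw [diffRows, countGood, key, key, bitValue_rippleAdd, hval, hval, sumBits]
    · simp
    · rw [length_countGood, length_countGood] <;> simp [levelQuad, levelList]

/-- With `s + 1` equal and `7 - s` opposite signs, the bad cases are `s ≤ 1` and `s ≥ 5`. -/
theorem levelQuad_zero (d : ℕ → ℕ → Bool) : levelQuad d 0 7 = finalQuad false true := by
  simp [levelQuad, levelList, HasBadCircuit, finalQuad, List.range_succ]

-- The backward recursion starts after row `6` with `G 7`, `G 8`, `G 9` given, so these three bits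
-- are summed over separately. Seven rows and three further additions turn one bit into the eleven
-- bits that `violates` expects.
open Classical in
theorem bitValue_countAll (D : ℕ → ℕ → Bool) (hD : ∀ i, D i 3 = false) (G : ℕ → Bool) :
    bitValue (countAll Bool.xor Bool.or cond false true (diffRows D 7)) =
      sumBits 10 G fun G => if IsGood D G then 1 else 0 := by
  have key : ∀ g₁ g₂ g₃ : Bool, bitValue (countGood Bool.xor Bool.or cond false true
      (diffRows D 7) g₁ g₂ g₃ (finalQuad false true)) =
      sumBits 7 (Function.update (Function.update (Function.update G 9 g₃) 8 g₂) 7 g₁)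
        fun G => if IsGood D G then 1 else 0 := by
    intro g₁ g₂ g₃
    have h := bitValue_countGood D hD 7 le_rfl
      (Function.update (Function.update (Function.update G 9 g₃) 8 g₂) 7 g₁)
    rw [Nat.sub_self, levelQuad_zero] at h
    rw [← h]
    simp [Function.update]
  have hlen : ∀ g₁ g₂ g₃ : Bool, (countGood Bool.xor Bool.or cond false true
      (diffRows D 7) g₁ g₂ g₃ (finalQuad false true)).length = 8 := fun g₁ g₂ g₃ =>
    length_countGood D 7 _ _ _ _ (by simp [finalQuad])
  have hlen₂ : ∀ g₂ g₃ : Bool, (rippleAdd Bool.xor cond false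
      (countGood Bool.xor Bool.or cond false true (diffRows D 7) false g₂ g₃ (finalQuad false true))
      (countGood Bool.xor Bool.or cond false true (diffRows D 7) true g₂ g₃
        (finalQuad false true))).length = 9 := fun g₂ g₃ => by
    rw [length_rippleAdd _ _ _ (by rw [hlen, hlen]), hlen]
  have hsum : ∀ F, sumBits 10 G F =
      let S := fun g₁ g₂ g₃ => sumBits 7
        (Function.update (Function.update (Function.update G 9 g₃) 8 g₂) 7 g₁) F
      ((S false false false + S true false false) + (S false true false + S true true false)) +
      ((S false false true + S true false true) + (S false true true + S true true true)) :=
    fun _ => rfl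
  rw [hsum]
  simp only [countAll, ← key]
  rw [bitValue_rippleAdd, bitValue_rippleAdd, bitValue_rippleAdd, bitValue_rippleAdd,
    bitValue_rippleAdd, bitValue_rippleAdd, bitValue_rippleAdd]
  · simp only [Bool.toNat_false, zero_add]
  all_goals first
    | rw [hlen, hlen]
    | rw [hlen₂, hlen₂]
    | exact (length_rippleAdd _ _ _ ((hlen₂ _ _).trans (hlen₂ _ _).symm)).trans
        ((congrArg (· + 1) ((hlen₂ _ _).trans (hlen₂ _ _).symm)).trans
          (length_rippleAdd _ _ _ ((hlen₂ _ _).trans (hlen₂ _ _).symm)).symm)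

/-- As `56 = 32 + 16 + 8`, a number below `64` is at least `56` exactly if its bits 3, 4 and 5 are
all set, and then equals `56` exactly if bits 0, 1 and 2 vanish. -/
theorem bitValue_le_of_violates_eq_false {ne : Bool} {L : List Bool}
    (h : violates Bool.xor Bool.or cond false true ne L = false) :
    bitValue L ≤ 56 ∧ (bitValue L = 56 ↔ ne = false) := by
  unfold violates at h
  split at h
  · rename_i c₀ c₁ c₂ c₃ c₄ c₅ c₆ c₇ c₈ c₉ c₁₀
    simp only [bitValue]
    simp only [Bool.or] at h
    cases c₆ <;> cases c₇ <;> cases c₈ <;> cases c₉ <;> cases c₁₀ <;> simp at h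
    revert h
    revert c₀ c₁ c₂ c₃ c₄ c₅ ne
    decide
  · simp at h

end CountSemantics

/-! ### Normal forms of reorientation classes and the extremal ones -/

section Codes

open Finset

/-- A subset is recovered from its membership bit at `0` and the successive changes of membership;
surjectivity follows by cardinality. -/
theorem reorientDiff_bijective (n : ℕ) : Function.Bijective fun R : Finset (Fin (n + 1)) =>
    (decide (0 ∈ R), fun c : Fin n => reorientDiff R c) := by
  rw [Fintype.bijective_iff_injective_and_card]
  constructor
  · intro R S h
    simp only [Prod.mk.injEq] at h
    obtain ⟨h0, h⟩ := h
    have hmem : ∀ (T : Finset (Fin (n + 1))) (e : Fin (n + 1)),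
        decide (∃ e' ∈ T, (e' : ℕ) = e) = decide (e ∈ T) := fun T e => by
      refine decide_eq_decide.2 ⟨fun ⟨e', h1, h2⟩ => Fin.ext h2 ▸ h1, fun h => ⟨e, h, rfl⟩⟩
    have key : ∀ e : Fin (n + 1), decide (e ∈ R) = decide (e ∈ S) := by
      intro e
      induction e using Fin.induction with
      | zero => exact h0
      | succ i ih =>
        have h1 := congrFun h i
        simp only [reorientDiff] at h1
        have hR := hmem R i.castSucc
        have hS := hmem S i.castSucc
        have hR' := hmem R i.succ
        have hS' := hmem S i.succ
        simp only [Fin.val_castSucc, Fin.val_succ] at hR hS hR' hS'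
        rw [hR, hS, hR', hS', ih] at h1
        have hcancel : ∀ a b c : Bool, (a ^^ b) = (a ^^ c) → b = c := by decide
        exact hcancel _ _ _ h1
    ext e
    exact decide_eq_decide.1 (key e)
  · simp [pow_succ, mul_comm]

/-- The sign differences of the normal form with the given free differences. -/
def codeDiff (b : Fin 18 → Bool) (i t : ℕ) : Bool :=
  if h : 1 ≤ i ∧ i ≤ 6 ∧ t < 3 then b ⟨3 * (i - 1) + t, by omega⟩ else false

/-- The Lawrence oriented matroid of a code. -/
noncomputable def codeMatroid (b : Fin 18 → Bool) : OrientedMatroid (Fin 11) :=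
  OrientedMatroid.lawrence (by norm_num : 7 ≤ 11) (signMatrix 7 11 (codeDiff b))
    (signMatrix_ne_zero _)

theorem circuits_codeMatroid (b : Fin 18 → Bool) :
    (codeMatroid b).circuits = lawrenceCircuits (signMatrix 7 11 (codeDiff b)) :=
  OrientedMatroid.circuits_lawrence _ _ _

/-- The cells `(0, t)` with `t ≤ 3` and `(i, 3)` with `i ≤ 6` meet each of the ten sums `i + t = 0,
…, 9` exactly once. So the differences of a reorientation can be chosen to clear precisely these
cells. -/
theorem exists_reorient_eq_codeMatroid {M : OrientedMatroid (Fin 11)} (hM : M.IsLawrence 7) :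
    ∃ (b : Fin 18 → Bool) (R : Finset (Fin 11)), M.reorient R = codeMatroid b := by
  obtain ⟨A, hA, hMA⟩ := hM.exists_circuits_eq
  obtain ⟨D, hD⟩ := exists_lawrenceCircuits_eq_signMatrix (w := 3) hA
  rw [hD] at hMA
  obtain ⟨R, hR⟩ := (reorientDiff_bijective 10).2
    (false, fun c => if (c : ℕ) ≤ 3 then D 0 c else D (c - 3) 3)
  simp only [Prod.mk.injEq] at hR
  have hg : ∀ c < 10, reorientDiff R c = if c ≤ 3 then D 0 c else D (c - 3) 3 :=
    fun c hc => congrFun hR.2 ⟨c, hc⟩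
  refine ⟨fun k => D (k / 3 + 1) (k % 3) ^^ reorientDiff R (k / 3 + 1 + k % 3), R, ?_⟩
  apply OrientedMatroid.ext
  refine (circuits_reorient_signMatrix (w := 3) hMA R).trans ?_
  rw [circuits_codeMatroid]
  refine lawrenceCircuits_signMatrix_congr (w := 3) fun i hi t ht => ?_
  unfold codeDiff
  split_ifs with h
  · simp only [show (3 * (i - 1) + t) / 3 + 1 = i by omega,
      show (3 * (i - 1) + t) % 3 = t by omega]
  · rw [hg _ (by omega)]
    rcases Nat.eq_zero_or_pos i with rfl | hi0
    · simp [ht]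
    · obtain rfl : t = 3 := by omega
      simp [show ¬ i + 3 ≤ 3 by omega]

/-- Both codes vanish on row `0` and at offset `3`, so a reorientation taking one to the other has
all ten differences zero and changes no sign change at all. -/
theorem codeMatroid_reorientationClass_injective :
    Function.Injective fun b => (codeMatroid b).reorientationClass := by
  intro b b' h
  obtain ⟨R, hR⟩ := (OrientedMatroid.mem_reorientationClass_iff _ _).2 h
  have hc := circuits_reorient_signMatrix (w := 3) (circuits_codeMatroid b') R
  rw [hR, circuits_codeMatroid] at hc
  have hdiff : ∀ i < 7, ∀ t ≤ 3, codeDiff b i t = (codeDiff b' i t ^^ reorientDiff R (i + t)) :=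
    fun i hi t ht => eq_of_lawrenceCircuits_signMatrix_eq (w := 3) hc hi ht
  have hg : ∀ c < 10, reorientDiff R c = false := by
    intro c hc
    by_cases h3 : c ≤ 3
    · have := hdiff 0 (by omega) c h3
      simpa [codeDiff] using this
    · have := hdiff (c - 3) (by omega) 3 le_rfl
      simpa [codeDiff, show c - 3 + 3 = c by omega] using this
  have hb : ∀ (b : Fin 18 → Bool) (k : Fin 18), b k = codeDiff b (k / 3 + 1) (k % 3) := by
    intro b k
    rw [codeDiff, dif_pos (by omega)]
    congr 1
    apply Fin.ext
    simp only
    omega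
  funext k
  rw [hb b, hb b', hdiff _ (by omega) _ (by omega), hg _ (by omega), Bool.xor_false]

-- The factor `2` is the free choice of whether `0 ∈ R`: complementary sets have the same
-- differences.
open Classical in
theorem neighborlyCount_eq_sumBits {M : OrientedMatroid (Fin 11)} {D : ℕ → ℕ → Bool}
    (hM : M.circuits = lawrenceCircuits (signMatrix 7 11 D)) :
    M.neighborlyCount 2 = 2 * sumBits 10 (fun _ => false) fun G => if IsGood D G then 1 else 0 := by
  have hgood : ∀ R : Finset (Fin 11), (M.reorient R).IsNeighborly 2 ↔
      IsGood D (fun k => if h : k < 10 then reorientDiff R k else false) := by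
    intro R
    refine isNeighborly_iff (w := 3) ((circuits_reorient_signMatrix (w := 3) hM R).trans ?_)
    refine lawrenceCircuits_signMatrix_congr (w := 3) fun i hi t ht => ?_
    simp [shiftDiff, show i + t < 10 by omega]
  have hsum := (Equiv.ofBijective _ (reorientDiff_bijective 10)).sum_comp
    fun x => if IsGood D (fun k => if h : k < 10 then x.2 ⟨k, h⟩ else false) then 1 else 0
  rw [Fintype.sum_prod_type, Fintype.sum_bool, ← two_mul,
    ← sumBits_eq_sum 10 (fun _ => false) fun G => if IsGood D G then 1 else 0] at hsum
  rw [← hsum, OrientedMatroid.neighborlyCount, Set.ncard_eq_toFinset_card', Set.toFinset_ofPred,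
    card_filter]
  exact sum_congr rfl fun R _ => if_congr (hgood R) rfl rfl

/-- The codes with the largest number of `2`-neighborly reorientations. -/
def extremalCodes : Set (Fin 18 → Bool) :=
  {b | notExtremal Bool.xor Bool.or (fun k => if h : k < 18 then b ⟨k, h⟩ else false) = false}

theorem neighborlyCount_codeMatroid (b : Fin 18 → Bool) :
    (codeMatroid b).neighborlyCount 2 ≤ 112 ∧
      ((codeMatroid b).neighborlyCount 2 = 112 ↔ b ∈ extremalCodes) := by
  rw [neighborlyCount_eq_sumBits (circuits_codeMatroid b),
    ← bitValue_countAll (codeDiff b) (by simp [codeDiff])]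
  have h := codeViolates_bool b
  rw [codeViolates] at h
  have h' := bitValue_le_of_violates_eq_false h
  have hrows : codeRows false (fun k => if h : k < 18 then b ⟨k, h⟩ else false) =
      diffRows (codeDiff b) 7 := by
    simp [codeRows, diffRows, codeDiff]
  rw [hrows] at h'
  refine ⟨by omega, ?_⟩
  rw [extremalCodes, Set.mem_ofPred_eq, ← h'.2]
  omega

/-- In terms of sign changes, extremality means `D 2 0 = 0`, `D i 1 = 0` for `2 ≤ i ≤ 6`, and `D i 2
= D (i + 2) 0` for `1 ≤ i ≤ 4`. Of the 18 bits, these ten independent equations leave eight free. -/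
theorem ncard_extremalCodes : extremalCodes.ncard = 256 := by
  set f : (Fin 8 → Bool) → Fin 18 → Bool := fun c =>
    ![c 0, c 1, c 2, false, false, c 3, c 2, false, c 4, c 3, false, c 5, c 4, false, c 6, c 5,
      false, c 7] with hf
  have hinj : Function.Injective f := by
    intro c c' h
    have h0 := congrFun h 0
    have h1 := congrFun h 1
    have h2 := congrFun h 2
    have h3 := congrFun h 5
    have h4 := congrFun h 8
    have h5 := congrFun h 11
    have h6 := congrFun h 14
    have h7 := congrFun h 17
    funext i
    fin_cases i
    exacts [h0, h1, h2, h3, h4, h5, h6, h7]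
  have hrange : extremalCodes = Set.range f := by
    ext b
    constructor
    · intro hb
      have hb' : notExtremal Bool.xor Bool.or
        (fun k => if h : k < 18 then b ⟨k, h⟩ else false) = false := hb
      simp [notExtremal] at hb'
      refine ⟨![b 0, b 1, b 2, b 5, b 8, b 11, b 14, b 17], ?_⟩
      funext k
      fin_cases k <;> simp_all
    · rintro ⟨c, rfl⟩
      simp [extremalCodes, notExtremal, hf]
  rw [hrange, ← Set.image_univ, Set.ncard_image_of_injective _ hinj, Set.ncard_univ]
  simp

theorem zero_mem_extremalCodes : (fun _ => false) ∈ extremalCodes := by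
  simp [extremalCodes, notExtremal]

theorem alternating_eq_codeMatroid :
    OrientedMatroid.alternating 7 11 = codeMatroid fun _ => false := by
  apply OrientedMatroid.ext
  rw [OrientedMatroid.circuits_alternating, circuits_codeMatroid]
  congr 1
  funext i c
  have h : ∀ (i k : ℕ), xorAccum (codeDiff (fun _ => false) i) k = false := by
    intro i k
    induction k with
    | zero => rfl
    | succ k ih => simp [xorAccum, ih, codeDiff]
  simp [signMatrix, h, boolSign]

end Codes

theorem mainTheorem8 :
    (OrientedMatroid.alternating 7 11).neighborlyCount 2 = 112 ∧
    (∀ M : OrientedMatroid (Fin 11), M.IsLawrence 7 →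
      M ∉ (OrientedMatroid.alternating 7 11).reorientationClass →
      M.neighborlyCount 2 ≤ (OrientedMatroid.alternating 7 11).neighborlyCount 2) ∧
    {K : Set (OrientedMatroid (Fin 11)) | ∃ M : OrientedMatroid (Fin 11),
      M.IsLawrence 7 ∧ M ∉ (OrientedMatroid.alternating 7 11).reorientationClass ∧
      K = M.reorientationClass ∧
      M.neighborlyCount 2 =
        (OrientedMatroid.alternating 7 11).neighborlyCount 2}.ncard = 255 := by
  have hcode : ∀ M : OrientedMatroid (Fin 11), M.IsLawrence 7 →
      ∃ b, M.reorientationClass = (codeMatroid b).reorientationClass := by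
    intro M hM
    obtain ⟨b, R, h⟩ := exists_reorient_eq_codeMatroid hM
    exact ⟨b, by rw [← h, OrientedMatroid.reorientationClass_reorient]⟩
  have halt : (OrientedMatroid.alternating 7 11).neighborlyCount 2 = 112 := by
    rw [alternating_eq_codeMatroid]
    exact (neighborlyCount_codeMatroid _).2.2 zero_mem_extremalCodes
  refine ⟨halt, fun M hM _ => ?_, ?_⟩
  · obtain ⟨b, hb⟩ := hcode M hM
    rw [halt, OrientedMatroid.neighborlyCount_eq_of_reorientationClass_eq hb]
    exact (neighborlyCount_codeMatroid b).1
  -- Classes of LOMs correspond to codes and the class of `C_7(11)` to the zero code, so excluding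
  -- that class removes one of the 256 extremal codes.
  · have hset : {K : Set (OrientedMatroid (Fin 11)) | ∃ M : OrientedMatroid (Fin 11),
        M.IsLawrence 7 ∧ M ∉ (OrientedMatroid.alternating 7 11).reorientationClass ∧
        K = M.reorientationClass ∧
        M.neighborlyCount 2 = (OrientedMatroid.alternating 7 11).neighborlyCount 2} =
        (fun b => (codeMatroid b).reorientationClass) '' (extremalCodes \ {fun _ => false}) := by
      ext K
      rw [halt, alternating_eq_codeMatroid]
      constructor
      · rintro ⟨M, hM, hMalt, rfl, hcount⟩
        obtain ⟨b, hb⟩ := hcode M hM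
        rw [OrientedMatroid.neighborlyCount_eq_of_reorientationClass_eq hb] at hcount
        refine ⟨b, ⟨(neighborlyCount_codeMatroid b).2.1 hcount, ?_⟩, hb.symm⟩
        rintro rfl
        exact hMalt ((OrientedMatroid.mem_reorientationClass_iff _ _).2 hb)
      · rintro ⟨b, ⟨hb, hb0⟩, rfl⟩
        refine ⟨codeMatroid b, OrientedMatroid.isLawrence_lawrence _ _ _, fun h => hb0 ?_, rfl,
          (neighborlyCount_codeMatroid b).2.2 hb⟩
        exact codeMatroid_reorientationClass_injective
          ((OrientedMatroid.mem_reorientationClass_iff _ _).1 h)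
    rw [hset, Set.ncard_image_of_injective _ codeMatroid_reorientationClass_injective,
      Set.ncard_sdiff_singleton_of_mem zero_mem_extremalCodes, ncard_extremalCodes]
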